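/- Let $\mathcal X\subset\mathbb R^d$ be compact and let $k:\mathcal X\times\mathcal X\to\mathbb R$ be a fixed measurable reproducing kernel with $k(x,x')\le 1$ for all $x,x'\in\mathcal X$. Let $f$ lie in the reproducing kernel Hilbert space $\mathcal H_k$ with $\|f\|_k\le B$, and let $x^\ast\in\arg\max_{x\in\mathcal X}f(x)$. Let $\sigma>0$ be the noise parameter of the Gaussian process (GP) surrogate. For past queries $x_1,\dots,x_{t-1}$ and observations $\mathbf y_{t-1}=(y_1,\dots,y_{t-1})^\top$ put $K_{t-1}=[k(x_i,x_j)]_{i,j<t}$, $k_{t-1}(x)=[k(x_i,x)]_{i<t}$ and $$\mu_{t-1}(x)=k_{t-1}(x)^\top(K_{t-1}+\sigma^2I)^{-1}\mathbf y_{t-1},\qquad \sigma_{t-1}^2(x)=k(x,x)-k_{t-1}(x)^\top(K_{t-1}+\sigma^2I)^{-1}k_{t-1}(x).$$ Let $\gamma_t=\sup_{a_1,\dots,a_t\in\mathcal X}\tfrac12\log\det\big(I+\sigma^{-2}[k(a_i,a_j)]_{i,j\le t}\big)$ be the maximum information gain (repetitions allowed). Fix $\delta\in(0,1)$ and a horizon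 $T$, and let $\beta_t(\delta)$ be non-decreasing in $t\in\{1,\dots,T\}$ with $$\beta_t(\delta)\ \ge\ 2B^2+300\,\gamma_t\,\log^3(t/\delta)\qquad(1\le t\le T);$$ in particular $\beta_t(\delta)=2B^2+300\,\gamma_t\log^3(t/\delta)$ is allowed. GP-UCB is run with the fixed kernel $k$ for $T$ rounds: in round $t$ it queries $$x_t\in\arg\max_{x\in\mathcal X}\ \mu_{t-1}(x)+\sqrt{\beta_t(\delta)}\,\sigma_{t-1}(x)$$ and observes $y_t=f(x_t)+\epsilon_t$. Here $(\mathcal F_t)_{t\ge0}$ is a filtration such that $x_t$ is $\mathcal F_{t-1}$-measurable and $\epsilon_t$ is $\mathcal F_t$-measurable, and the noise is conditionally $R$-sub-Gaussian with $0\le R\le\sigma$: for all $1\le t\le T$ and $\eta\in\mathbb R$, almost surely $$\mathbb E[\exp(\eta\epsilon_t)\mid\mathcal F_{t-1}]\le\exp(\eta^2R^2/2).$$ Then, with probability at least $1-\delta$, the cumulative regret $R_T=\sum_{t=1}^T\big(f(x^\ast)-f(x_t)\big)$ satisfies $$R_T\ \le\ \sqrt{T\sum_{t=1}^T4\,\beta_t(\delta)\,\sigma^2\,C\,\log\!\big(1+\sigma^{-2}\sigma_{t-1}^2(x_t)\big)},\qquad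 C=\frac{\sigma^{-2}}{\log(1+\sigma^{-2})}.$$ -/

import Mathlib

open MeasureTheory

noncomputable section

namespace GPUCB

/-- The Gram matrix `[k (x i) (x j)]` of the query points `x 0, …, x (n - 1)`. -/
def gram {X : Type*} (k : X → X → ℝ) {n : ℕ} (x : Fin n → X) : Matrix (Fin n) (Fin n) ℝ :=
  Matrix.of fun i j => k (x i) (x j)

/-- The regularized Gram matrix `K + σ² I`. -/
def regGram {X : Type*} (k : X → X → ℝ) (σ : ℝ) {n : ℕ} (x : Fin n → X) :
    Matrix (Fin n) (Fin n) ℝ :=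
  gram k x + σ ^ 2 • (1 : Matrix (Fin n) (Fin n) ℝ)

/-- The vector `[k (x i) z]` of covariances between the query points and a test point `z`. -/
def kvec {X : Type*} (k : X → X → ℝ) {n : ℕ} (x : Fin n → X) (z : X) : Fin n → ℝ :=
  fun i => k (x i) z

/-- The Gaussian process predictive mean `k(z)ᵀ (K + σ² I)⁻¹ y`. -/
def postMean {X : Type*} (k : X → X → ℝ) (σ : ℝ) {n : ℕ} (x : Fin n → X) (y : Fin n → ℝ)
    (z : X) : ℝ :=
  kvec k x z ⬝ᵥ Matrix.mulVec (regGram k σ x)⁻¹ y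

/-- The Gaussian process predictive variance `k(z,z) - k(z)ᵀ (K + σ² I)⁻¹ k(z)`. -/
def postVar {X : Type*} (k : X → X → ℝ) (σ : ℝ) {n : ℕ} (x : Fin n → X) (z : X) : ℝ :=
  k z z - kvec k x z ⬝ᵥ Matrix.mulVec (regGram k σ x)⁻¹ (kvec k x z)

/-- The values `u 1, …, u (t - 1)` of a sequence before round `t`. -/
def past {α : Type*} (u : ℕ → α) (t : ℕ) : Fin (t - 1) → α :=
  fun i => u ((i : ℕ) + 1)

/-- The upper confidence bound acquisition function of round `t`, at exploration level `b`,
for the query sequence `x` and the observation sequence `y`. -/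
def ucb {X : Type*} (k : X → X → ℝ) (σ b : ℝ) (x : ℕ → X) (y : ℕ → ℝ) (t : ℕ) (z : X) : ℝ :=
  postMean k σ (past x t) (past y t) z + √b * √(postVar k σ (past x t) z)

/-- The maximum information gain after `t` evaluations: the supremum of
`1/2 log det (I + σ⁻² K_A)` over all `t`-tuples `A` of points (repetitions are allowed). -/
def maxInfoGain {X : Type*} (k : X → X → ℝ) (σ : ℝ) (t : ℕ) : ℝ :=
  ⨆ A : Fin t → X,
    1 / 2 * Real.log (1 + (σ ^ 2)⁻¹ • gram k A : Matrix (Fin t) (Fin t) ℝ).det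

/-- The random variable `e` is conditionally `R`-sub-Gaussian given the σ-algebra `m`:
`E[exp (η e) | m] ≤ exp (η² R² / 2)` almost surely, for every real `η`. -/
def CondSubGaussian {Ω : Type*} {mΩ : MeasurableSpace Ω} (P : Measure Ω)
    (m : MeasurableSpace Ω) (R : ℝ) (e : Ω → ℝ) : Prop :=
  ∀ η : ℝ, Integrable (fun ω => Real.exp (η * e ω)) P ∧
    P[fun ω => Real.exp (η * e ω) | m] ≤ᵐ[P] fun _ => Real.exp (η ^ 2 * R ^ 2 / 2)

end GPUCB

end

noncomputable section

namespace GPUCB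
open Matrix

/-! With kernel sections as feature vectors, the error of the posterior mean splits into a bias
term, at most `B` times the posterior deviation, and a noise term, at most the posterior deviation
times the square root of `noiseQuad` (`sub_postMean_abs_le`). The whole problem is to bound
`noiseQuad` along adaptively chosen queries.

For a fixed regularization `τ`, the process `exp (noiseQuad / 2) / √det (1 + τ⁻² K)` is a
supermartingale started at one. Adding a query changes both factors by an explicit one-dimensional
expression, which is a Gaussian mixture of exponentials linear in the new noise, and `R ≤ σ` lets
the sub-Gaussian bound absorb it (`CondSubGaussian.lintegral_mul_quad_le`). Markov's inequality at
each sample size `n`, with threshold `n (n + 1) / δ`, and a union bound leave total failure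
probability at most `δ`. Since every sample size has its own process, `τ` may depend on `n`.

The exploration level has no additive `log (1 / δ)` term: its noise part is proportional to the
information gain `γ`, however small. The plain choice `τ = σ` does not give this when `γ < 1/2`.
There the kernel is inflated by `γ⁻¹`, that is `τ² = γ σ²`: the log-determinant stays bounded, and
going back from `τ` to `σ` gains a factor of order `γ` (`noiseQuad_le_of_expSupermartingale_lt`).

On the good event the regret of a round is at most twice the confidence width at the query;
Cauchy–Schwarz over the rounds and concavity of the logarithm finish the proof. -/

theorem exists_spectral_data {n : ℕ} {K : Matrix (Fin n) (Fin n) ℝ} (hK : K.PosSemidef) :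
    ∃ l : Fin n → ℝ, (∀ i, 0 ≤ l i) ∧ K.trace = ∑ i, l i ∧
      (∀ c : ℝ, (1 + c • K).det = ∏ i, (1 + c * l i)) ∧
      ∀ e : Fin n → ℝ, ∃ w : Fin n → ℝ, e ⬝ᵥ e = ∑ i, w i ^ 2 ∧
        ∀ s : ℝ, 0 < s → e ⬝ᵥ (K + s • (1 : Matrix (Fin n) (Fin n) ℝ))⁻¹ *ᵥ e =
          ∑ i, w i ^ 2 / (l i + s) := by
  classical
  set U : Matrix (Fin n) (Fin n) ℝ := hK.isHermitian.eigenvectorUnitary.1 with hU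
  set l := hK.isHermitian.eigenvalues with hl
  have hl0 : ∀ i, 0 ≤ l i := hK.eigenvalues_nonneg
  have hUU : U * Uᵀ = 1 := by
    have := Unitary.coe_mul_star_self hK.isHermitian.eigenvectorUnitary
    simpa [star_eq_conjTranspose] using this
  have hUU' : Uᵀ * U = 1 := mul_eq_one_comm.mp hUU
  have hKU : K = U * diagonal l * Uᵀ := by
    have := hK.isHermitian.spectral_theorem
    rw [Unitary.conjStarAlgAut_apply] at this
    simpa [star_eq_conjTranspose, Function.comp_def] using this
  -- The coordinates of `e` in the eigenbasis do not depend on `s`, so quadratic forms at different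
  -- regularizations can later be compared term by term.
  refine ⟨l, hl0, ?_, fun c => ?_, fun e => ⟨Uᵀ *ᵥ e, ?_, fun s hs => ?_⟩⟩
  · simpa using hK.isHermitian.trace_eq_sum_eigenvalues
  · have : 1 + c • K = U * diagonal (fun i => 1 + c * l i) * Uᵀ := by
      have h1 : diagonal (fun i => 1 + c * l i) = 1 + c • diagonal l := by
        ext i j
        by_cases h : i = j <;> simp [h, diagonal]
      rw [h1, mul_add, add_mul, mul_one, hUU, mul_smul_comm, smul_mul_assoc, ← hKU]
    rw [this, det_mul_right_comm, hUU, one_mul, det_diagonal]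
  · have : (Uᵀ *ᵥ e) ⬝ᵥ (Uᵀ *ᵥ e) = e ⬝ᵥ e := by
      rw [dotProduct_mulVec, vecMul_transpose, mulVec_mulVec, hUU, one_mulVec]
    rw [← this]
    simp [dotProduct, sq]
  · have hinv : (K + s • (1 : Matrix (Fin n) (Fin n) ℝ))⁻¹ =
        U * diagonal (fun i => (l i + s)⁻¹) * Uᵀ := by
      apply inv_eq_right_inv
      have h1 : K + s • (1 : Matrix (Fin n) (Fin n) ℝ) = U * diagonal (fun i => l i + s) * Uᵀ := by
        have h1 : diagonal (fun i => l i + s) = diagonal l + s • 1 := by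
          ext i j
          by_cases h : i = j <;> simp [h, diagonal]
        rw [h1, mul_add, add_mul, mul_smul_comm, smul_mul_assoc, mul_one, hUU, ← hKU]
      rw [h1]
      calc _ = U * diagonal (fun i => l i + s) * (Uᵀ * U) * diagonal (fun i => (l i + s)⁻¹) * Uᵀ := by
            simp only [Matrix.mul_assoc]
        _ = 1 := by
            rw [hUU', mul_one, Matrix.mul_assoc U, diagonal_mul_diagonal]
            have : (fun i => (l i + s) * (l i + s)⁻¹) = fun _ => 1 := by
              funext i
              exact mul_inv_cancel₀ (by have := hl0 i; positivity)
            rw [this, diagonal_one, mul_one, hUU]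
    rw [hinv, ← mulVec_mulVec, ← mulVec_mulVec, dotProduct_mulVec, ← mulVec_transpose]
    simp only [dotProduct, mulVec_diagonal]
    exact Finset.sum_congr rfl fun i _ => by rw [sq, div_eq_mul_inv]; ring

/-! ### Kernel ridge regression in feature space -/

section Deterministic

variable {X H : Type*} [NormedAddCommGroup H] [InnerProductSpace ℝ H]
  {k : X → X → ℝ} {φ : X → H}

theorem gram_posSemidef (hφ : ∀ z w, k z w = inner ℝ (φ z) (φ w)) {n : ℕ} (x : Fin n → X) :
    (gram k x).PosSemidef := by
  have : gram k x = Matrix.gram ℝ (fun i => φ (x i)) := by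
    ext i j
    simp [gram, hφ, Matrix.gram]
  rw [this]
  exact posSemidef_gram ℝ _

theorem regGram_posDef (hφ : ∀ z w, k z w = inner ℝ (φ z) (φ w)) {τ : ℝ} (hτ : 0 < τ)
    {n : ℕ} (x : Fin n → X) : (regGram k τ x).PosDef := by
  refine PosDef.posSemidef_add (gram_posSemidef hφ x) ?_
  exact PosDef.smul PosDef.one (by positivity)

theorem regGram_mulVec_inv (hφ : ∀ z w, k z w = inner ℝ (φ z) (φ w)) {τ : ℝ} (hτ : 0 < τ)
    {n : ℕ} (x : Fin n → X) (v : Fin n → ℝ) :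
    regGram k τ x *ᵥ ((regGram k τ x)⁻¹ *ᵥ v) = v := by
  rw [mulVec_mulVec, mul_nonsing_inv _ ((regGram_posDef hφ hτ x).det_pos.ne'.isUnit), one_mulVec]

theorem gram_mulVec_add (hφ : ∀ z w, k z w = inner ℝ (φ z) (φ w)) {τ : ℝ} (hτ : 0 < τ)
    {n : ℕ} (x : Fin n → X) (v : Fin n → ℝ) :
    gram k x *ᵥ ((regGram k τ x)⁻¹ *ᵥ v) = v - τ ^ 2 • ((regGram k τ x)⁻¹ *ᵥ v) := by
  have := regGram_mulVec_inv hφ hτ x v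
  generalize (regGram k τ x)⁻¹ *ᵥ v = w at this ⊢
  rw [← this, regGram, add_mulVec, smul_mulVec, one_mulVec, add_sub_cancel_right]

theorem dotProduct_inv_comm (hφ : ∀ z w, k z w = inner ℝ (φ z) (φ w)) {τ : ℝ} (hτ : 0 < τ)
    {n : ℕ} (x : Fin n → X) (u v : Fin n → ℝ) :
    u ⬝ᵥ (regGram k τ x)⁻¹ *ᵥ v = v ⬝ᵥ (regGram k τ x)⁻¹ *ᵥ u := by
  have hs : ((regGram k τ x)⁻¹)ᵀ = (regGram k τ x)⁻¹ := by
    have := (regGram_posDef hφ hτ x).inv.isHermitian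
    simpa [IsHermitian] using this
  rw [dotProduct_mulVec, ← mulVec_transpose, hs, dotProduct_comm]

theorem inner_sum_feature (hφ : ∀ z w, k z w = inner ℝ (φ z) (φ w)) {n : ℕ} (x : Fin n → X)
    (a b : Fin n → ℝ) :
    inner ℝ (∑ i, a i • φ (x i)) (∑ i, b i • φ (x i)) = a ⬝ᵥ gram k x *ᵥ b := by
  simp only [sum_inner, inner_sum, inner_smul_left, inner_smul_right, dotProduct, mulVec, gram,
    of_apply, hφ, Finset.mul_sum]
  rw [Finset.sum_comm]
  refine Finset.sum_congr rfl fun i _ => Finset.sum_congr rfl fun j _ => ?_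
  simp; ring

theorem inner_feature_sum (hφ : ∀ z w, k z w = inner ℝ (φ z) (φ w)) {n : ℕ} (x : Fin n → X)
    (z : X) (b : Fin n → ℝ) :
    inner ℝ (φ z) (∑ i, b i • φ (x i)) = kvec k x z ⬝ᵥ b := by
  simp only [inner_sum, inner_smul_right, dotProduct, kvec, hφ]
  refine Finset.sum_congr rfl fun i _ => ?_
  rw [real_inner_comm]; ring

/-- The residual of the feature vector of `z` after kernel ridge regression on the queries. -/
def residual (k : X → X → ℝ) (φ : X → H) (τ : ℝ) {n : ℕ} (x : Fin n → X) (z : X) : H :=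
  φ z - ∑ i, ((regGram k τ x)⁻¹ *ᵥ kvec k x z) i • φ (x i)

/-- The posterior variance is the value of the ridge objective at its minimizer. This exhibits it as
a squared norm in `H ⊕ ℝⁿ`, ready for Cauchy–Schwarz. -/
theorem postVar_eq (hφ : ∀ z w, k z w = inner ℝ (φ z) (φ w)) {τ : ℝ} (hτ : 0 < τ)
    {n : ℕ} (x : Fin n → X) (z : X) :
    postVar k τ x z = ‖residual k φ τ x z‖ ^ 2 + τ ^ 2 *
      (((regGram k τ x)⁻¹ *ᵥ kvec k x z) ⬝ᵥ ((regGram k τ x)⁻¹ *ᵥ kvec k x z)) := by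
  set α := (regGram k τ x)⁻¹ *ᵥ kvec k x z with hα
  rw [residual, norm_sub_sq_real, ← real_inner_self_eq_norm_sq, ← real_inner_self_eq_norm_sq,
    inner_sum_feature hφ, inner_feature_sum hφ, ← hφ, gram_mulVec_add hφ hτ, ← hα, postVar, ← hα,
    dotProduct_sub, dotProduct_smul, dotProduct_comm α (kvec k x z), smul_eq_mul]
  ring

theorem postVar_nonneg (hφ : ∀ z w, k z w = inner ℝ (φ z) (φ w)) {τ : ℝ} (hτ : 0 < τ)
    {n : ℕ} (x : Fin n → X) (z : X) : 0 ≤ postVar k τ x z := by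
  rw [postVar_eq hφ hτ]
  have := dotProduct_self_star_nonneg ((regGram k τ x)⁻¹ *ᵥ kvec k x z)
  simp only [star_trivial] at this
  positivity

theorem postVar_le (hφ : ∀ z w, k z w = inner ℝ (φ z) (φ w)) {τ : ℝ} (hτ : 0 < τ)
    {n : ℕ} (x : Fin n → X) (z : X) : postVar k τ x z ≤ k z z := by
  have := (regGram_posDef hφ hτ x).inv.posSemidef.dotProduct_mulVec_nonneg (kvec k x z)
  simp only [star_trivial] at this
  rw [postVar]
  linarith

/-- The squared self-normalized norm of the noise vector `e`, that is,
`σ⁻² eᵀ K (K + σ² I)⁻¹ e`. -/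
def noiseQuad (k : X → X → ℝ) (σ τ : ℝ) {n : ℕ} (x : Fin n → X) (e : Fin n → ℝ) : ℝ :=
  (e ⬝ᵥ e - τ ^ 2 * (e ⬝ᵥ (regGram k τ x)⁻¹ *ᵥ e)) / σ ^ 2

/-- The error is `⟪f, p⟫ - (⟪p, h⟫ + α ⬝ᵥ v)` with `p` the ridge residual. The bracket pairs `(p, σ
α)` with `(h, v / σ)` in `H ⊕ ℝⁿ`; the squared norms of these two vectors are exactly `postVar` and
`noiseQuad`. -/
theorem sub_postMean_abs_le (hφ : ∀ z w, k z w = inner ℝ (φ z) (φ w)) {σ : ℝ} (hσ : 0 < σ)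
    {n : ℕ} (x : Fin n → X) (e : Fin n → ℝ) (f : H) {B : ℝ} (hB : ‖f‖ ≤ B) (z : X) :
    |inner ℝ f (φ z) - postMean k σ x (fun i => inner ℝ f (φ (x i)) + e i) z| ≤
      √(postVar k σ x z) * (B + √(noiseQuad k σ σ x e)) := by
  set α := (regGram k σ x)⁻¹ *ᵥ kvec k x z with hα
  set w := (regGram k σ x)⁻¹ *ᵥ e with hw
  set p := residual k φ σ x z with hp
  set h : H := ∑ i, w i • φ (x i) with hh
  set v := gram k x *ᵥ w with hv
  have hve : v = e - σ ^ 2 • w := gram_mulVec_add hφ hσ x e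
  have hV := postVar_eq hφ hσ x z
  rw [← hα, ← hp] at hV
  have hαα : 0 ≤ α ⬝ᵥ α := by simpa using dotProduct_self_star_nonneg α
  have hvv : 0 ≤ v ⬝ᵥ v := by simpa using dotProduct_self_star_nonneg v
  have hV0 : 0 ≤ postVar k σ x z := postVar_nonneg hφ hσ x z
  have hpV : ‖p‖ ≤ √(postVar k σ x z) := by
    apply Real.le_sqrt_of_sq_le
    rw [hV]
    have := mul_nonneg (sq_nonneg σ) hαα
    linarith
  have hmean : postMean k σ x (fun i => inner ℝ f (φ (x i)) + e i) z =
      inner ℝ f (∑ i, α i • φ (x i)) + kvec k x z ⬝ᵥ w := by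
    rw [postMean, dotProduct_inv_comm hφ hσ, ← hα, hw, dotProduct_inv_comm hφ hσ x _ e, ← hα]
    simp only [dotProduct, inner_sum, inner_smul_right, ← Finset.sum_add_distrib]
    exact Finset.sum_congr rfl fun i _ => by ring
  have hkw : kvec k x z ⬝ᵥ w = inner ℝ p h + α ⬝ᵥ v := by
    rw [hp, residual, inner_sub_left, ← hα, hh, inner_feature_sum hφ, inner_sum_feature hφ, ← hv]
    ring
  have hQ : noiseQuad k σ σ x e = ‖h‖ ^ 2 + v ⬝ᵥ v / σ ^ 2 := by
    rw [← real_inner_self_eq_norm_sq, inner_sum_feature hφ, ← hv, noiseQuad, ← hw]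
    have h1 : e = v + σ ^ 2 • w := by rw [hve]; simp
    have h2 : e ⬝ᵥ e = e ⬝ᵥ v + σ ^ 2 * (e ⬝ᵥ w) := by
      nth_rewrite 2 [h1]
      simp
    have h3 : e ⬝ᵥ v = v ⬝ᵥ v + σ ^ 2 * (w ⬝ᵥ v) := by
      nth_rewrite 1 [h1]
      simp
    rw [h2, h3]
    field_simp
    ring
  have hQ0 : 0 ≤ noiseQuad k σ σ x e := by rw [hQ]; positivity
  have hcs : |inner ℝ p h + α ⬝ᵥ v| ≤ √(postVar k σ x z) * √(noiseQuad k σ σ x e) := by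
    have h1 : |inner ℝ p h| ≤ ‖p‖ * ‖h‖ := abs_real_inner_le_norm p h
    have h2 : |α ⬝ᵥ v| ≤ √(α ⬝ᵥ α) * √(v ⬝ᵥ v) := by
      have := abs_real_inner_le_norm (WithLp.toLp 2 α) (WithLp.toLp 2 v)
      rw [EuclideanSpace.norm_eq, EuclideanSpace.norm_eq] at this
      simpa [dotProduct, PiLp.inner_apply, sq, mul_comm] using this
    rw [← Real.sqrt_mul hV0]
    apply Real.le_sqrt_of_sq_le
    rw [sq_abs, hV, hQ]
    have h3 : (inner ℝ p h + α ⬝ᵥ v) ^ 2 ≤ (‖p‖ * ‖h‖ + √(α ⬝ᵥ α) * √(v ⬝ᵥ v)) ^ 2 := by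
      rw [← sq_abs]
      exact pow_le_pow_left₀ (abs_nonneg _) ((abs_add_le _ _).trans (add_le_add h1 h2)) 2
    refine h3.trans ?_
    have ha := Real.sq_sqrt hαα
    have hb := Real.sq_sqrt hvv
    set a := √(α ⬝ᵥ α)
    set b := √(v ⬝ᵥ v)
    rw [← ha, ← hb]
    -- Lagrange's identity: the defect in the two-term Cauchy–Schwarz inequality is a square.
    have : (‖p‖ ^ 2 + σ ^ 2 * a ^ 2) * (‖h‖ ^ 2 + b ^ 2 / σ ^ 2) -
        (‖p‖ * ‖h‖ + a * b) ^ 2 = (‖p‖ * b / σ - σ * a * ‖h‖) ^ 2 := by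
      field_simp
      ring
    linarith [sq_nonneg (‖p‖ * b / σ - σ * a * ‖h‖)]
  have hfp : |inner ℝ f p| ≤ B * √(postVar k σ x z) :=
    (abs_real_inner_le_norm f p).trans
      (mul_le_mul hB hpV (norm_nonneg _) ((norm_nonneg _).trans hB))
  have : inner ℝ f (φ z) - postMean k σ x (fun i => inner ℝ f (φ (x i)) + e i) z =
      inner ℝ f p - (inner ℝ p h + α ⬝ᵥ v) := by
    have hfp : inner ℝ f p = inner ℝ f (φ z) - inner ℝ f (∑ i, α i • φ (x i)) := by
      rw [hp, residual, inner_sub_right, ← hα]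
    rw [hmean, hkw, hfp]
    ring
  rw [this]
  refine (abs_sub _ _).trans ?_
  linarith

/-! ### Adding one query -/

/-- Innovation form of block elimination: the Schur complement of the old block is `τ² + postVar`,
and the new term is the squared prediction error over it. -/
theorem regGram_inv_quad_succ (hφ : ∀ z w, k z w = inner ℝ (φ z) (φ w)) {τ : ℝ} (hτ : 0 < τ)
    {n : ℕ} (x : Fin (n + 1) → X) (e : Fin (n + 1) → ℝ) :
    e ⬝ᵥ (regGram k τ x)⁻¹ *ᵥ e =
      (fun i : Fin n => e i.castSucc) ⬝ᵥ
        (regGram k τ fun i : Fin n => x i.castSucc)⁻¹ *ᵥ (fun i : Fin n => e i.castSucc) +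
      (e (Fin.last n) - postMean k τ (fun i : Fin n => x i.castSucc)
        (fun i : Fin n => e i.castSucc) (x (Fin.last n))) ^ 2 /
        (τ ^ 2 + postVar k τ (fun i : Fin n => x i.castSucc) (x (Fin.last n))) := by
  set x' : Fin n → X := fun i => x i.castSucc with hx'
  set y : Fin n → ℝ := fun i => e i.castSucc with hy
  set z := x (Fin.last n) with hz
  set t := e (Fin.last n) with ht
  set b := kvec k x' z with hb
  set u := (regGram k τ x')⁻¹ *ᵥ y with hu
  set p := (regGram k τ x')⁻¹ *ᵥ b with hp
  have hAu : regGram k τ x' *ᵥ u = y := regGram_mulVec_inv hφ hτ x' y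
  have hAp : regGram k τ x' *ᵥ p = b := regGram_mulVec_inv hφ hτ x' b
  have hm : postMean k τ x' y z = b ⬝ᵥ u := rfl
  have hv : postVar k τ x' z = k z z - b ⬝ᵥ p := rfl
  have hv0 := postVar_nonneg hφ hτ x' z
  have hyp : y ⬝ᵥ p = b ⬝ᵥ u := dotProduct_inv_comm hφ hτ x' y b
  set s := τ ^ 2 + postVar k τ x' z with hs
  have hs0 : 0 < s := by positivity
  set r := (t - b ⬝ᵥ u) / s with hr
  -- The solution of the bordered system is written down and checked row by row, which avoids a
  -- formula for the full inverse.
  have hsol : regGram k τ x *ᵥ (Fin.snoc (fun i => u i - r * p i) r : Fin (n + 1) → ℝ) = e := by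
    funext j
    refine Fin.lastCases ?_ (fun j => ?_) j
    · have h1 : (regGram k τ x *ᵥ (Fin.snoc (fun i => u i - r * p i) r : Fin (n + 1) → ℝ))
          (Fin.last n) = b ⬝ᵥ (fun i => u i - r * p i) + (k z z + τ ^ 2) * r := by
        simp only [mulVec, dotProduct, Fin.sum_univ_castSucc, Fin.snoc_castSucc, Fin.snoc_last,
          regGram, gram, Matrix.add_apply, of_apply, Matrix.smul_apply, one_apply_eq, smul_eq_mul, mul_one, hb,
          kvec, hx', ← hz]
        congr 1
        refine Finset.sum_congr rfl fun i _ => ?_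
        rw [one_apply_ne (Fin.castSucc_lt_last i).ne', hφ, hφ, real_inner_comm]
        ring
      have h2 : b ⬝ᵥ (fun i => u i - r * p i) = b ⬝ᵥ u - r * (b ⬝ᵥ p) := by
        simp only [dotProduct, mul_sub, Finset.sum_sub_distrib, Finset.mul_sum]
        congr 1
        exact Finset.sum_congr rfl fun i _ => by ring
      rw [h1, h2, ← ht]
      have : r * s = t - b ⬝ᵥ u := div_mul_cancel₀ _ hs0.ne'
      rw [hs, hv] at this
      linarith
    · have h1 : (regGram k τ x *ᵥ (Fin.snoc (fun i => u i - r * p i) r : Fin (n + 1) → ℝ))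
          j.castSucc = (regGram k τ x' *ᵥ (fun i => u i - r * p i)) j + b j * r := by
        simp only [mulVec, dotProduct, Fin.sum_univ_castSucc, Fin.snoc_castSucc, Fin.snoc_last,
          regGram, gram, Matrix.add_apply, of_apply, Matrix.smul_apply, smul_eq_mul, hb, kvec, hx', ← hz]
        rw [one_apply_ne (Fin.castSucc_lt_last j).ne]
        congr 1
        · refine Finset.sum_congr rfl fun i _ => ?_
          simp [one_apply]
        · ring
      have h2 : (fun i => u i - r * p i) = u - r • p := by
        funext i; simp
      rw [h1, h2, mulVec_sub, mulVec_smul, hAu, hAp]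
      simp [hy, mul_comm]
  have hinv : (regGram k τ x)⁻¹ *ᵥ e = (Fin.snoc (fun i => u i - r * p i) r : Fin (n + 1) → ℝ) := by
    conv_lhs => rw [← hsol]
    rw [mulVec_mulVec, nonsing_inv_mul _ ((regGram_posDef hφ hτ x).det_pos.ne'.isUnit), one_mulVec]
  have h3 : e ⬝ᵥ (Fin.snoc (fun i => u i - r * p i) r : Fin (n + 1) → ℝ) =
      y ⬝ᵥ u - r * (y ⬝ᵥ p) + t * r := by
    simp only [dotProduct, Fin.sum_univ_castSucc, Fin.snoc_castSucc, Fin.snoc_last, mul_sub,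
      Finset.sum_sub_distrib, Finset.mul_sum, hy, ← ht]
    congr 2
    exact Finset.sum_congr rfl fun i _ => by ring
  rw [hinv, h3, hyp, hm, hr]
  field_simp
  ring

theorem det_regGram_succ (hφ : ∀ z w, k z w = inner ℝ (φ z) (φ w)) {τ : ℝ} (hτ : 0 < τ)
    {n : ℕ} (x : Fin (n + 1) → X) :
    (regGram k τ x).det = (regGram k τ fun i : Fin n => x i.castSucc).det *
      (τ ^ 2 + postVar k τ (fun i : Fin n => x i.castSucc) (x (Fin.last n))) := by
  set x' : Fin n → X := fun i => x i.castSucc with hx'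
  set z := x (Fin.last n) with hz
  have hA := (regGram_posDef hφ hτ x').det_pos.ne'.isUnit
  let _ : Invertible (regGram k τ x') := invertibleOfIsUnitDet _ hA
  have hblock : (regGram k τ x).submatrix finSumFinEquiv finSumFinEquiv =
      fromBlocks (regGram k τ x') (of fun i (_ : Fin 1) => kvec k x' z i)
        (of fun (_ : Fin 1) i => kvec k x' z i) (of fun _ _ => k z z + τ ^ 2) := by
    ext i j
    rcases i with i | i <;> rcases j with j | j
    · simp [regGram, gram, hx', one_apply, Fin.ext_iff]
      rfl
    · have : Fin.natAdd n j = Fin.last n := by ext; simp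
      have h2 : Fin.castAdd 1 i = i.castSucc := rfl
      simp [regGram, gram, hx', this, kvec, h2, ← hz, one_apply_ne (Fin.castSucc_lt_last i).ne]
    · have : Fin.natAdd n i = Fin.last n := by ext; simp
      have h2 : Fin.castAdd 1 j = j.castSucc := rfl
      simp [regGram, gram, hx', this, kvec, h2, ← hz, one_apply_ne (Fin.castSucc_lt_last j).ne']
      rw [hφ, hφ, real_inner_comm]
    · have : Fin.natAdd n i = Fin.last n := by ext; simp
      have h2 : Fin.natAdd n j = Fin.last n := by ext; simp
      simp [regGram, gram, this, h2, ← hz]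
  rw [← det_submatrix_equiv_self finSumFinEquiv (regGram k τ x), hblock, det_fromBlocks₁₁]
  congr 1
  rw [det_fin_one, postVar, dotProduct_mulVec]
  simp only [Matrix.sub_apply, of_apply, mul_apply, invOf_eq_nonsing_inv, dotProduct, vecMul]
  ring

theorem regGram_eq_smul {τ : ℝ} (hτ : 0 < τ) {n : ℕ} (x : Fin n → X) :
    regGram k τ x = τ ^ 2 • (1 + (τ ^ 2)⁻¹ • gram k x) := by
  rw [smul_add, smul_smul, mul_inv_cancel₀ (by positivity), one_smul, regGram, add_comm]

theorem det_one_add_gram_succ (hφ : ∀ z w, k z w = inner ℝ (φ z) (φ w)) {τ : ℝ} (hτ : 0 < τ)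
    {n : ℕ} (x : Fin (n + 1) → X) :
    (1 + (τ ^ 2)⁻¹ • gram k x).det = (1 + (τ ^ 2)⁻¹ • gram k fun i : Fin n => x i.castSucc).det *
      (1 + (τ ^ 2)⁻¹ * postVar k τ (fun i : Fin n => x i.castSucc) (x (Fin.last n))) := by
  have h := det_regGram_succ hφ hτ x
  rw [regGram_eq_smul hτ, regGram_eq_smul hτ, det_smul, det_smul, Fintype.card_fin,
    Fintype.card_fin] at h
  have hτn : (τ ^ 2) ^ (n + 1) ≠ 0 := by positivity
  apply mul_left_cancel₀ hτn
  have hv (v : ℝ) : τ ^ 2 + v = τ ^ 2 * (1 + (τ ^ 2)⁻¹ * v) := by field_simp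
  rw [h, pow_succ _ n, hv]
  ring

theorem one_le_det_one_add_gram (hφ : ∀ z w, k z w = inner ℝ (φ z) (φ w)) {c : ℝ} (hc : 0 ≤ c)
    {n : ℕ} (x : Fin n → X) : 1 ≤ (1 + c • gram k x).det := by
  obtain ⟨l, hl0, -, hdet, -⟩ := exists_spectral_data (gram_posSemidef hφ x)
  rw [hdet]
  exact Finset.one_le_prod fun i => by have := mul_nonneg hc (hl0 i); simpa using this

/-! ### The maximum information gain -/

theorem log_det_le (hφ : ∀ z w, k z w = inner ℝ (φ z) (φ w)) (hk : ∀ z w, k z w ≤ 1) {σ : ℝ}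
    (hσ : 0 < σ) {n : ℕ} (x : Fin n → X) :
    1 / 2 * Real.log (1 + (σ ^ 2)⁻¹ • gram k x).det ≤ maxInfoGain k σ n := by
  -- A real supremum is meaningful only for a bounded family. The bound comes from `log (1 + s) ≤ s`
  -- on the eigenvalues and a trace of at most `n`.
  refine le_ciSup (f := fun A : Fin n → X => 1 / 2 * Real.log (1 + (σ ^ 2)⁻¹ • gram k A).det)
    ⟨1 / 2 * ((σ ^ 2)⁻¹ * n), ?_⟩ x
  rintro _ ⟨A, rfl⟩
  obtain ⟨l, hl0, htr, hdet, -⟩ := exists_spectral_data (gram_posSemidef hφ A)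
  have hpos : ∀ i, 0 < 1 + (σ ^ 2)⁻¹ * l i := fun i => by have := hl0 i; positivity
  have h1 : ∑ i, l i ≤ n := by
    rw [← htr, trace]
    refine (Finset.sum_le_card_nsmul Finset.univ _ 1 fun i _ => ?_).trans (by simp)
    exact hk (A i) (A i)
  simp only
  rw [hdet, Real.log_prod (fun i _ => (hpos i).ne')]
  gcongr
  calc ∑ i, Real.log (1 + (σ ^ 2)⁻¹ * l i) ≤ ∑ i, (σ ^ 2)⁻¹ * l i :=
        Finset.sum_le_sum fun i _ => by linarith [Real.log_le_sub_one_of_pos (hpos i)]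
    _ = (σ ^ 2)⁻¹ * ∑ i, l i := by rw [Finset.mul_sum]
    _ ≤ _ := by gcongr

theorem maxInfoGain_nonneg [Nonempty X] (hφ : ∀ z w, k z w = inner ℝ (φ z) (φ w))
    (hk : ∀ z w, k z w ≤ 1) {σ : ℝ} (hσ : 0 < σ) (n : ℕ) : 0 ≤ maxInfoGain k σ n := by
  refine le_trans ?_ (log_det_le hφ hk hσ fun _ : Fin n => Classical.arbitrary X)
  have := Real.log_nonneg
    (one_le_det_one_add_gram hφ (c := (σ ^ 2)⁻¹) (by positivity) fun _ : Fin n => Classical.arbitrary X)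
  positivity

/-- Round `n + 1` has only `n` observations but its exploration level uses the gain of `n + 1`
points; the extra point can only increase the determinant. -/
theorem log_det_castSucc_le (hφ : ∀ z w, k z w = inner ℝ (φ z) (φ w)) (hk : ∀ z w, k z w ≤ 1)
    {σ : ℝ} (hσ : 0 < σ) {n : ℕ} (x : Fin (n + 1) → X) :
    Real.log (1 + (σ ^ 2)⁻¹ • gram k fun i : Fin n => x i.castSucc).det ≤
      2 * maxInfoGain k σ (n + 1) := by
  have h1 := log_det_le hφ hk hσ x
  have h2 := one_le_det_one_add_gram hφ (c := (σ ^ 2)⁻¹) (by positivity) fun i : Fin n => x i.castSucc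
  have h3 := postVar_nonneg hφ hσ (fun i : Fin n => x i.castSucc) (x (Fin.last n))
  have h4 : Real.log (1 + (σ ^ 2)⁻¹ • gram k fun i : Fin n => x i.castSucc).det ≤
      Real.log (1 + (σ ^ 2)⁻¹ • gram k x).det := by
    apply Real.log_le_log (by linarith)
    rw [det_one_add_gram_succ hφ hσ]
    apply le_mul_of_one_le_right (by linarith)
    have : 0 ≤ (σ ^ 2)⁻¹ * postVar k σ (fun i : Fin n => x i.castSucc) (x (Fin.last n)) := by
      positivity
    linarith
  linarith

end Deterministic


/-! ### Sub-Gaussian bounds with predictable random exponents -/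

section Probability

open ENNReal Filter Topology

theorem ofReal_gaussian_lintegral {v : ℝ} (hv : 0 < v) (b : ℝ) :
    ∫⁻ u : ℝ, ENNReal.ofReal (Real.exp (-u ^ 2 / (2 * v) + b * u)) =
      ENNReal.ofReal (√(2 * Real.pi * v) * Real.exp (b ^ 2 * v / 2)) := by
  lift v to NNReal using hv.le
  have h := ProbabilityTheory.lintegral_gaussianPDFReal_eq_one (b * v) (v := v)
    (by exact_mod_cast hv.ne')
  have h2 : ∀ u : ℝ, ENNReal.ofReal (Real.exp (-u ^ 2 / (2 * v) + b * u)) =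
      ENNReal.ofReal (√(2 * Real.pi * v) * Real.exp (b ^ 2 * v / 2)) *
        ENNReal.ofReal (ProbabilityTheory.gaussianPDFReal (b * v) v u) := by
    intro u
    rw [← ENNReal.ofReal_mul (by positivity), ProbabilityTheory.gaussianPDFReal_def]
    congr 1
    have h3 : -u ^ 2 / (2 * (v : ℝ)) + b * u =
        b ^ 2 * v / 2 + -(u - b * v) ^ 2 / (2 * v) := by
      field_simp
      ring
    rw [h3, Real.exp_add]
    field_simp
  simp_rw [h2]
  rw [lintegral_const_mul _ (by fun_prop), h, mul_one]

theorem tendsto_int_floor_mul_div (a : ℝ) :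
    Tendsto (fun n : ℕ => (⌊a * n⌋ : ℝ) / n) atTop (𝓝 a) := by
  have h1 : Tendsto (fun n : ℕ => a - 1 / (n : ℝ)) atTop (𝓝 a) := by
    simpa using tendsto_const_nhds.sub (tendsto_one_div_atTop_nhds_zero_nat (𝕜 := ℝ))
  refine tendsto_of_tendsto_of_tendsto_of_le_of_le' h1 tendsto_const_nhds ?_ ?_
  · filter_upwards [eventually_gt_atTop 0] with n hn
    have hn' : (0 : ℝ) < n := by exact_mod_cast hn
    rw [le_div_iff₀ hn', sub_mul, one_div, inv_mul_cancel₀ hn'.ne']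
    exact (Int.sub_one_lt_floor _).le
  · filter_upwards [eventually_gt_atTop 0] with n hn
    have hn' : (0 : ℝ) < n := by exact_mod_cast hn
    rw [div_le_iff₀ hn']
    exact Int.floor_le _

variable {Ω : Type*} {m mΩ : MeasurableSpace Ω} {P : Measure Ω} [IsProbabilityMeasure P]
  {e : Ω → ℝ} {R : ℝ}

/-- The conditional bound becomes an inequality between measures restricted to `m`, so the weight
`g` needs no integrability. -/
theorem CondSubGaussian.lintegral_mul_exp_le (he : CondSubGaussian P m R e) (hm : m ≤ mΩ)
    (hme : Measurable e) (η : ℝ) {g : Ω → ℝ≥0∞} (hg : Measurable[m] g) :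
    ∫⁻ ω, g ω * ENNReal.ofReal (Real.exp (η * e ω)) ∂P ≤
      ∫⁻ ω, g ω * ENNReal.ofReal (Real.exp (η ^ 2 * R ^ 2 / 2)) ∂P := by
  obtain ⟨hint, hce⟩ := he η
  have hw : Measurable fun ω => ENNReal.ofReal (Real.exp (η * e ω)) := by fun_prop
  set c := Real.exp (η ^ 2 * R ^ 2 / 2) with hc
  set ν := P.withDensity fun ω => ENNReal.ofReal (Real.exp (η * e ω)) with hν
  have hle : ν.trim hm ≤ ENNReal.ofReal c • P.trim hm := by
    refine Measure.le_iff.mpr fun s hs => ?_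
    rw [trim_measurableSet_eq hm hs, Measure.smul_apply, trim_measurableSet_eq hm hs, hν,
      withDensity_apply _ (hm s hs), ← ofReal_integral_eq_lintegral_ofReal hint.integrableOn
        (ae_of_all _ fun ω => (Real.exp_pos _).le), ← setIntegral_condExp hm hint hs, smul_eq_mul]
    have h1 : ∫ ω in s, (P[fun ω => Real.exp (η * e ω) | m]) ω ∂P ≤ ∫ _ in s, c ∂P :=
      integral_mono_ae integrable_condExp.integrableOn (integrable_const c)
        (ae_restrict_of_ae hce)
    refine (ENNReal.ofReal_le_ofReal h1).trans ?_
    rw [setIntegral_const, smul_eq_mul, mul_comm, ENNReal.ofReal_mul (Real.exp_pos _).le,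
      ofReal_measureReal]
  have hg' : Measurable g := hg.mono hm le_rfl
  calc ∫⁻ ω, g ω * ENNReal.ofReal (Real.exp (η * e ω)) ∂P = ∫⁻ ω, g ω ∂ν := by
        rw [hν, lintegral_withDensity_eq_lintegral_mul _ hw hg']
        simp [mul_comm]
    _ = ∫⁻ ω, g ω ∂(ν.trim hm) := (lintegral_trim hm hg).symm
    _ ≤ ∫⁻ ω, g ω ∂(ENNReal.ofReal c • P.trim hm) := lintegral_mono' hle le_rfl
    _ = _ := by
        rw [lintegral_smul_measure, lintegral_trim hm hg, lintegral_mul_const _ hg', smul_eq_mul,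
          mul_comm]

theorem CondSubGaussian.lintegral_mul_exp_countable_le (he : CondSubGaussian P m R e)
    (hm : m ≤ mΩ) (hme : Measurable e) {ξ : Ω → ℤ} (hξ : Measurable[m] ξ) (q : ℤ → ℝ)
    {g : Ω → ℝ≥0∞} (hg : Measurable[m] g) :
    ∫⁻ ω, g ω * ENNReal.ofReal (Real.exp (q (ξ ω) * e ω - q (ξ ω) ^ 2 * R ^ 2 / 2)) ∂P ≤
      ∫⁻ ω, g ω ∂P := by
  have hs : ∀ j, MeasurableSet[m] (ξ ⁻¹' {j}) := fun j => hξ (measurableSet_singleton j)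
  have hU : ⋃ j, ξ ⁻¹' {j} = Set.univ := by
    ext ω; simp
  have hd : Pairwise (Function.onFun Disjoint fun j => ξ ⁻¹' {j}) := fun i j hij =>
    Disjoint.preimage _ (by simpa using hij)
  rw [← setLIntegral_univ, ← setLIntegral_univ (μ := P) g, ← hU,
    lintegral_iUnion (fun j => hm _ (hs j)) hd, lintegral_iUnion (fun j => hm _ (hs j)) hd]
  refine ENNReal.tsum_le_tsum fun j => ?_
  set c := q j ^ 2 * R ^ 2 / 2 with hc
  have h1 := he.lintegral_mul_exp_le hm hme (q j)
    (g := fun ω => (ξ ⁻¹' {j}).indicator g ω * ENNReal.ofReal (Real.exp (-c)))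
    ((hg.indicator (hs j)).mul_const _)
  calc _ = ∫⁻ ω in ξ ⁻¹' {j}, g ω * ENNReal.ofReal (Real.exp (-c)) *
          ENNReal.ofReal (Real.exp (q j * e ω)) ∂P := by
        refine setLIntegral_congr_fun (hm _ (hs j)) fun ω hω => ?_
        have : ξ ω = j := hω
        simp only [this]
        rw [mul_assoc, ← ENNReal.ofReal_mul (Real.exp_pos _).le, ← Real.exp_add]
        congr 3
        ring
    _ = ∫⁻ ω, (ξ ⁻¹' {j}).indicator g ω * ENNReal.ofReal (Real.exp (-c)) *
          ENNReal.ofReal (Real.exp (q j * e ω)) ∂P := by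
        rw [← lintegral_indicator (hm _ (hs j))]
        refine lintegral_congr fun ω => ?_
        by_cases h : ω ∈ ξ ⁻¹' {j} <;> simp [h]
    _ ≤ _ := h1
    _ = ∫⁻ ω, (ξ ⁻¹' {j}).indicator g ω ∂P := by
        refine lintegral_congr fun ω => ?_
        rw [mul_assoc, ← ENNReal.ofReal_mul (Real.exp_pos _).le, ← Real.exp_add, ← hc]
        simp
    _ = _ := lintegral_indicator (hm _ (hs j)) g

/-- The hypothesis holds almost surely for each fixed exponent, with an exceptional set depending on
it. A predictable exponent is therefore approximated by countably valued ones, treated on their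
level sets, and Fatou's lemma passes to the limit. -/
theorem CondSubGaussian.lintegral_mul_exp_random_le (he : CondSubGaussian P m R e) (hm : m ≤ mΩ)
    (hme : Measurable e) {ζ : Ω → ℝ} (hζ : Measurable[m] ζ) {g : Ω → ℝ≥0∞}
    (hg : Measurable[m] g) :
    ∫⁻ ω, g ω * ENNReal.ofReal (Real.exp (ζ ω * e ω - ζ ω ^ 2 * R ^ 2 / 2)) ∂P ≤
      ∫⁻ ω, g ω ∂P := by
  set ξ : ℕ → Ω → ℤ := fun n ω => ⌊ζ ω * n⌋ with hξ
  have hξm : ∀ n, Measurable[m] (ξ n) := fun n =>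
    Int.measurable_floor.comp (hζ.mul_const _)
  have hlim : ∀ ω, Tendsto (fun n : ℕ => (ξ n ω : ℝ) / n) atTop (𝓝 (ζ ω)) := fun ω =>
    tendsto_int_floor_mul_div _
  set F : ℕ → Ω → ℝ≥0∞ := fun n ω => g ω * ENNReal.ofReal
    (Real.exp ((ξ n ω : ℝ) / n * e ω - ((ξ n ω : ℝ) / n) ^ 2 * R ^ 2 / 2)) with hF
  have hFm : ∀ n, Measurable (F n) := fun n => by
    have h1 : Measurable (ξ n) := (hξm n).mono hm le_rfl
    have h2 : Measurable g := hg.mono hm le_rfl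
    have h3 : Measurable fun ω => (ξ n ω : ℝ) := measurable_from_top.comp h1
    fun_prop
  have hFl : ∀ ω, Tendsto (fun n => F n ω) atTop
      (𝓝 (g ω * ENNReal.ofReal (Real.exp (ζ ω * e ω - ζ ω ^ 2 * R ^ 2 / 2)))) := fun ω => by
    -- The weight may be infinite; multiplication is still continuous here because the limit of the
    -- other factor is nonzero.
    refine ENNReal.Tendsto.const_mul (ENNReal.tendsto_ofReal ?_) (Or.inl (by simp [Real.exp_pos]))
    have := hlim ω
    exact (Real.continuous_exp.tendsto _).comp
      ((this.mul_const _).sub (((this.pow 2).mul_const _).div_const _))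
  calc _ = ∫⁻ ω, liminf (fun n => F n ω) atTop ∂P :=
        lintegral_congr fun ω => (hFl ω).liminf_eq.symm
    _ ≤ liminf (fun n => ∫⁻ ω, F n ω ∂P) atTop := lintegral_liminf_le hFm
    _ ≤ liminf (fun _ : ℕ => ∫⁻ ω, g ω ∂P) atTop := by
        refine liminf_le_liminf (Eventually.of_forall fun n => ?_)
        exact he.lintegral_mul_exp_countable_le hm hme (hξm n) (fun j => (j : ℝ) / n) hg
    _ = _ := by simp

end Probability

/-! ### The one-step Gaussian mixture -/

section Probability

open ENNReal Filter Topology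

variable {Ω : Type*} {m mΩ : MeasurableSpace Ω} {P : Measure Ω} [IsProbabilityMeasure P]
  {e : Ω → ℝ} {R : ℝ}

/-- Linearize the square in `e` by integrating `exp (ζ u * e)` over a Gaussian variable `u`.
Tonelli's theorem allows the sub-Gaussian bound to be applied for each `u`; the compensators left
over then integrate to at most one. -/
theorem CondSubGaussian.lintegral_mul_quad_le (he : CondSubGaussian P m R e) (hm : m ≤ mΩ)
    (hme : Measurable e) {σ : ℝ} (hσ : 0 < σ) (hR : 0 ≤ R) (hRσ : R ≤ σ) {μ D : Ω → ℝ}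
    (hμ : Measurable[m] μ) (hD : Measurable[m] D) (hD1 : ∀ ω, 1 ≤ D ω) {g : Ω → ℝ≥0∞}
    (hg : Measurable[m] g) :
    ∫⁻ ω, g ω * ENNReal.ofReal
        (Real.exp (1 / 2 * ((e ω ^ 2 - (e ω - μ ω) ^ 2 / D ω) / σ ^ 2)) / √(D ω)) ∂P ≤
      ∫⁻ ω, g ω ∂P := by
  have hD0 : ∀ ω, 0 < D ω := fun ω => by linarith [hD1 ω]
  -- `b` and `c` are twice the quadratic coefficient and the linear coefficient in `e` of the target
  -- exponent; `κ` collects the constant term and the normalization.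
  set b : Ω → ℝ := fun ω => (1 - 1 / D ω) / σ ^ 2 with hb
  have hb0 : ∀ ω, 0 ≤ b ω := fun ω => by
    have : 1 / D ω ≤ 1 := by rw [div_le_one (hD0 ω)]; exact hD1 ω
    exact div_nonneg (by linarith) (by positivity)
  set c : Ω → ℝ := fun ω => μ ω / (D ω * σ ^ 2) with hc
  set ζ : ℝ → Ω → ℝ := fun u ω => c ω + √(b ω) * u with hζ
  set κ : Ω → ℝ := fun ω => Real.exp (-μ ω ^ 2 / (2 * D ω * σ ^ 2)) / √(D ω) / √(2 * Real.pi)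
    with hκ
  have hκ0 : ∀ ω, 0 ≤ κ ω := fun ω => by positivity
  set G : ℝ → Ω → ℝ≥0∞ := fun u ω => g ω * ENNReal.ofReal (κ ω) *
    ENNReal.ofReal (Real.exp (-u ^ 2 / 2 + ζ u ω ^ 2 * R ^ 2 / 2)) with hG
  have hbm : Measurable[m] b := (measurable_const.sub (measurable_const.div hD)).div_const _
  have hcm : Measurable[m] c := hμ.div (hD.mul_const _)
  have hζm : ∀ u, Measurable[m] (ζ u) := fun u => hcm.add ((Real.continuous_sqrt.measurable.comp hbm).mul_const _)
  have hκm : Measurable[m] κ := by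
    refine ((Measurable.div ?_ (Real.continuous_sqrt.measurable.comp hD))).div_const _
    exact Real.measurable_exp.comp ((hμ.pow_const 2).neg.div ((hD.const_mul 2).mul_const _))
  have hGm : ∀ u, Measurable[m] (G u) := fun u => by
    refine (hg.mul (ENNReal.measurable_ofReal.comp hκm)).mul (ENNReal.measurable_ofReal.comp ?_)
    exact Real.measurable_exp.comp
      (measurable_const.add ((((hζm u).pow_const 2).mul_const _).div_const _))
  have hb' : Measurable b := hbm.mono hm le_rfl
  have hc' : Measurable c := hcm.mono hm le_rfl
  have hκ' : Measurable κ := hκm.mono hm le_rfl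
  have hg' : Measurable g := hg.mono hm le_rfl
  have hζ' : Measurable fun p : Ω × ℝ => ζ p.2 p.1 := by fun_prop
  have hG' : Measurable fun p : Ω × ℝ => G p.2 p.1 := by fun_prop
  have hmix : ∀ ω, g ω * ENNReal.ofReal
      (Real.exp (1 / 2 * ((e ω ^ 2 - (e ω - μ ω) ^ 2 / D ω) / σ ^ 2)) / √(D ω)) =
      ∫⁻ u : ℝ, G u ω * ENNReal.ofReal (Real.exp (ζ u ω * e ω - ζ u ω ^ 2 * R ^ 2 / 2)) := by
    intro ω
    have h1 : ∀ u : ℝ, G u ω * ENNReal.ofReal (Real.exp (ζ u ω * e ω - ζ u ω ^ 2 * R ^ 2 / 2)) =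
        g ω * ENNReal.ofReal (κ ω * Real.exp (c ω * e ω)) *
          ENNReal.ofReal (Real.exp (-u ^ 2 / (2 * 1) + (√(b ω) * e ω) * u)) := fun u => by
      simp only [hG]
      rw [mul_assoc, mul_assoc, mul_assoc, ← ENNReal.ofReal_mul (Real.exp_pos _).le, ← Real.exp_add,
        ← ENNReal.ofReal_mul (hκ0 ω), ← ENNReal.ofReal_mul (by have := hκ0 ω; positivity),
        mul_assoc (κ ω), ← Real.exp_add]
      congr 4
      simp only [hζ]
      ring
    simp_rw [h1]
    rw [lintegral_const_mul _ (by fun_prop), ofReal_gaussian_lintegral one_pos, mul_assoc,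
      ← ENNReal.ofReal_mul (by have := hκ0 ω; positivity)]
    congr 2
    have h2 : (√(b ω) * e ω) ^ 2 = b ω * e ω ^ 2 := by rw [mul_pow, Real.sq_sqrt (hb0 ω)]
    have h3 : 1 / 2 * ((e ω ^ 2 - (e ω - μ ω) ^ 2 / D ω) / σ ^ 2) =
        -μ ω ^ 2 / (2 * D ω * σ ^ 2) + c ω * e ω + b ω * e ω ^ 2 * 1 / 2 := by
      have := (hD0 ω).ne'
      simp only [hb, hc]
      field_simp
      ring
    rw [h2, h3, Real.exp_add, Real.exp_add, mul_one, hκ]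
    field_simp
  have hfinal : ∀ ω, ∫⁻ u : ℝ, G u ω ≤ g ω := by
    intro ω
    have h1 : ∀ u : ℝ, G u ω ≤ g ω * ENNReal.ofReal (κ ω * Real.exp (c ω ^ 2 * σ ^ 2 / 2)) *
        ENNReal.ofReal (Real.exp (-u ^ 2 / (2 * D ω) + (c ω * √(b ω) * σ ^ 2) * u)) := fun u => by
      simp only [hG]
      rw [mul_assoc, mul_assoc, ← ENNReal.ofReal_mul (hκ0 ω),
        ← ENNReal.ofReal_mul (by have := hκ0 ω; positivity), mul_assoc (κ ω), ← Real.exp_add]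
      refine mul_le_mul_right (ENNReal.ofReal_le_ofReal
        (mul_le_mul_of_nonneg_left (Real.exp_le_exp.mpr ?_) (hκ0 ω))) _
      -- With `R` replaced by `σ`, the remaining Gaussian has variance exactly `D`, which cancels
      -- the `√D` in `κ`.
      have h2 : ζ u ω ^ 2 * R ^ 2 / 2 ≤ ζ u ω ^ 2 * σ ^ 2 / 2 := by gcongr
      have h3 : ζ u ω ^ 2 * σ ^ 2 / 2 = c ω ^ 2 * σ ^ 2 / 2 + (c ω * √(b ω) * σ ^ 2) * u +
          (1 - 1 / D ω) * u ^ 2 / 2 := by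
        have h4 : ζ u ω ^ 2 = c ω ^ 2 + 2 * (c ω * √(b ω)) * u + b ω * u ^ 2 := by
          rw [← Real.sq_sqrt (hb0 ω)]
          simp only [hζ, Real.sqrt_sq (Real.sqrt_nonneg _)]
          ring
        rw [h4]
        simp only [hb]
        field_simp
      have h5 : -u ^ 2 / 2 + (1 - 1 / D ω) * u ^ 2 / 2 = -u ^ 2 / (2 * D ω) := by
        have := (hD0 ω).ne'
        field_simp
        ring
      linarith
    refine (lintegral_mono h1).trans_eq ?_
    rw [lintegral_const_mul _ (by fun_prop), ofReal_gaussian_lintegral (hD0 ω), mul_assoc,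
      ← ENNReal.ofReal_mul (by have := hκ0 ω; positivity)]
    have h2 : κ ω * Real.exp (c ω ^ 2 * σ ^ 2 / 2) *
        (√(2 * Real.pi * D ω) * Real.exp ((c ω * √(b ω) * σ ^ 2) ^ 2 * D ω / 2)) = 1 := by
      have h3 : (c ω * √(b ω) * σ ^ 2) ^ 2 = c ω ^ 2 * b ω * σ ^ 4 := by
        rw [mul_pow, mul_pow, Real.sq_sqrt (hb0 ω)]; ring
      have h4 : -μ ω ^ 2 / (2 * D ω * σ ^ 2) + c ω ^ 2 * σ ^ 2 / 2 +
          c ω ^ 2 * b ω * σ ^ 4 * D ω / 2 = 0 := by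
        have := (hD0 ω).ne'
        simp only [hb, hc]
        field_simp
        ring
      have h5 : √(D ω) ≠ 0 := (Real.sqrt_pos.mpr (hD0 ω)).ne'
      rw [h3, Real.sqrt_mul (by positivity), hκ]
      calc _ = Real.exp (-μ ω ^ 2 / (2 * D ω * σ ^ 2)) * Real.exp (c ω ^ 2 * σ ^ 2 / 2) *
            Real.exp (c ω ^ 2 * b ω * σ ^ 4 * D ω / 2) := by field_simp
        _ = 1 := by rw [← Real.exp_add, ← Real.exp_add, h4, Real.exp_zero]
    rw [h2, ENNReal.ofReal_one, mul_one]
  simp_rw [hmix]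
  rw [lintegral_lintegral_swap (by
    have : Measurable fun p : Ω × ℝ => G p.2 p.1 *
        ENNReal.ofReal (Real.exp (ζ p.2 p.1 * e p.1 - ζ p.2 p.1 ^ 2 * R ^ 2 / 2)) := by fun_prop
    exact this.aemeasurable)]
  calc _ ≤ ∫⁻ u : ℝ, ∫⁻ ω, G u ω ∂P :=
        lintegral_mono fun u => he.lintegral_mul_exp_random_le hm hme (hζm u) (hGm u)
    _ = ∫⁻ ω, (∫⁻ u : ℝ, G u ω) ∂P := by
        rw [lintegral_lintegral_swap (f := fun ω u => G u ω) hG'.aemeasurable]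
    _ ≤ _ := lintegral_mono hfinal

end Probability

/-! ### Measurability in the random queries and noise -/

section Measurability

variable {Ω X : Type*} [mΩ : MeasurableSpace Ω] [MeasurableSpace X] {k : X → X → ℝ}

theorem measurable_det {n : ℕ} {A : Ω → Matrix (Fin n) (Fin n) ℝ}
    (hA : ∀ i j, Measurable fun ω => A ω i j) : Measurable fun ω => (A ω).det := by
  have h : Measurable fun ω => (fun i j => A ω i j : Fin n → Fin n → ℝ) :=
    measurable_pi_lambda _ fun i => measurable_pi_lambda _ fun j => hA i j
  have hc : Continuous fun B : Fin n → Fin n → ℝ => (Matrix.of B).det :=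
    Continuous.matrix_det (continuous_id (X := Matrix (Fin n) (Fin n) ℝ))
  exact hc.measurable.comp h

theorem measurable_inv_apply {n : ℕ} {A : Ω → Matrix (Fin n) (Fin n) ℝ}
    (hA : ∀ i j, Measurable fun ω => A ω i j) (i j : Fin n) :
    Measurable fun ω => (A ω)⁻¹ i j := by
  have h : Measurable fun ω => (fun i j => A ω i j : Fin n → Fin n → ℝ) :=
    measurable_pi_lambda _ fun i => measurable_pi_lambda _ fun j => hA i j
  have hc : Continuous fun B : Fin n → Fin n → ℝ => (Matrix.of B).adjugate i j :=
    (Continuous.matrix_adjugate (continuous_id (X := Matrix (Fin n) (Fin n) ℝ))).matrix_elem i j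
  have h2 : Measurable fun ω => (A ω).adjugate i j := hc.measurable.comp h
  simp only [Matrix.inv_def, Matrix.smul_apply, Ring.inverse_eq_inv', smul_eq_mul]
  exact (measurable_det hA).inv.mul h2

theorem measurable_gram (hk : Measurable (Function.uncurry k)) {n : ℕ} {x : Fin n → Ω → X}
    (hx : ∀ i, Measurable (x i)) (i j : Fin n) :
    Measurable fun ω => gram k (fun i => x i ω) i j :=
  hk.comp ((hx i).prodMk (hx j))

theorem measurable_regGram_inv (hk : Measurable (Function.uncurry k)) (τ : ℝ) {n : ℕ}
    {x : Fin n → Ω → X} (hx : ∀ i, Measurable (x i)) (i j : Fin n) :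
    Measurable fun ω => (regGram k τ fun i => x i ω)⁻¹ i j := by
  refine measurable_inv_apply (fun i j => ?_) i j
  simp only [regGram, Matrix.add_apply]
  exact (measurable_gram hk hx i j).add measurable_const

theorem measurable_regGram_quad (hk : Measurable (Function.uncurry k)) (τ : ℝ) {n : ℕ}
    {x : Fin n → Ω → X} (hx : ∀ i, Measurable (x i)) {u v : Fin n → Ω → ℝ}
    (hu : ∀ i, Measurable (u i)) (hv : ∀ i, Measurable (v i)) :
    Measurable fun ω => (fun i => u i ω) ⬝ᵥ (regGram k τ fun i => x i ω)⁻¹ *ᵥ fun i => v i ω := by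
  simp only [dotProduct, mulVec]
  exact Finset.measurable_fun_sum _ fun i _ => (hu i).mul (Finset.measurable_fun_sum _ fun j _ =>
    (measurable_regGram_inv hk τ hx i j).mul (hv j))

theorem measurable_postMean (hk : Measurable (Function.uncurry k)) (τ : ℝ) {n : ℕ}
    {x : Fin n → Ω → X} (hx : ∀ i, Measurable (x i)) {y : Fin n → Ω → ℝ}
    (hy : ∀ i, Measurable (y i)) {z : Ω → X} (hz : Measurable z) :
    Measurable fun ω => postMean k τ (fun i => x i ω) (fun i => y i ω) (z ω) :=
  measurable_regGram_quad hk τ hx (fun i => hk.comp ((hx i).prodMk hz)) hy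

theorem measurable_postVar (hk : Measurable (Function.uncurry k)) (τ : ℝ) {n : ℕ}
    {x : Fin n → Ω → X} (hx : ∀ i, Measurable (x i)) {z : Ω → X} (hz : Measurable z) :
    Measurable fun ω => postVar k τ (fun i => x i ω) (z ω) :=
  (hk.comp (hz.prodMk hz)).sub (measurable_regGram_quad hk τ hx
    (fun i => hk.comp ((hx i).prodMk hz)) (fun i => hk.comp ((hx i).prodMk hz)))

theorem measurable_noiseQuad (hk : Measurable (Function.uncurry k)) (σ τ : ℝ) {n : ℕ}
    {x : Fin n → Ω → X} (hx : ∀ i, Measurable (x i)) {e : Fin n → Ω → ℝ}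
    (he : ∀ i, Measurable (e i)) :
    Measurable fun ω => noiseQuad k σ τ (fun i => x i ω) (fun i => e i ω) := by
  refine (Measurable.sub ?_ ((measurable_regGram_quad hk τ hx he he).const_mul _)).div_const _
  simp only [dotProduct]
  exact Finset.measurable_fun_sum _ fun i _ => (he i).mul (he i)

/-- The self-normalized exponential supermartingale, evaluated at `n` queries `x` and noise
values `e`. -/
def expSupermartingale (k : X → X → ℝ) (σ τ : ℝ) {n : ℕ} (x : Fin n → X) (e : Fin n → ℝ) : ℝ :=
  Real.exp (1 / 2 * noiseQuad k σ τ x e) / √(1 + (τ ^ 2)⁻¹ • gram k x).det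

theorem measurable_expSupermartingale (hk : Measurable (Function.uncurry k)) (σ τ : ℝ) {n : ℕ}
    {x : Fin n → Ω → X} (hx : ∀ i, Measurable (x i)) {e : Fin n → Ω → ℝ}
    (he : ∀ i, Measurable (e i)) :
    Measurable fun ω => expSupermartingale k σ τ (fun i => x i ω) (fun i => e i ω) := by
  refine Measurable.div (Real.measurable_exp.comp ((measurable_noiseQuad hk σ τ hx he).const_mul _))
    (Real.continuous_sqrt.measurable.comp (measurable_det fun i j => ?_))
  simp only [Matrix.add_apply, Matrix.smul_apply, smul_eq_mul]
  exact measurable_const.add ((measurable_gram hk hx i j).const_mul _)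

end Measurability

/-! ### The self-normalized supermartingale -/

section Supermartingale

variable {X H : Type*} [NormedAddCommGroup H] [InnerProductSpace ℝ H]
  {k : X → X → ℝ} {φ : X → H}

theorem noiseQuad_succ (hφ : ∀ z w, k z w = inner ℝ (φ z) (φ w)) (σ : ℝ) {τ : ℝ} (hτ : 0 < τ)
    {n : ℕ} (x : Fin (n + 1) → X) (e : Fin (n + 1) → ℝ) :
    noiseQuad k σ τ x e = noiseQuad k σ τ (fun i : Fin n => x i.castSucc) (fun i => e i.castSucc) +
      (e (Fin.last n) ^ 2 - (e (Fin.last n) - postMean k τ (fun i : Fin n => x i.castSucc)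
        (fun i : Fin n => e i.castSucc) (x (Fin.last n))) ^ 2 /
        (1 + (τ ^ 2)⁻¹ * postVar k τ (fun i : Fin n => x i.castSucc) (x (Fin.last n)))) / σ ^ 2 := by
  have hv := postVar_nonneg hφ hτ (fun i : Fin n => x i.castSucc) (x (Fin.last n))
  have h2 : e ⬝ᵥ e = (fun i : Fin n => e i.castSucc) ⬝ᵥ (fun i : Fin n => e i.castSucc) +
      e (Fin.last n) ^ 2 := by
    simp [dotProduct, Fin.sum_univ_castSucc, sq]
  have h3 (v a : ℝ) (hv : 0 ≤ v) : τ ^ 2 * (a / (τ ^ 2 + v)) = a / (1 + (τ ^ 2)⁻¹ * v) := by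
    have : τ ^ 2 + v ≠ 0 := by positivity
    field_simp
  rw [noiseQuad, regGram_inv_quad_succ hφ hτ, h2, noiseQuad, mul_add, h3 _ _ hv]
  ring

theorem expSupermartingale_succ (hφ : ∀ z w, k z w = inner ℝ (φ z) (φ w)) (σ : ℝ) {τ : ℝ}
    (hτ : 0 < τ) {n : ℕ} (x : Fin (n + 1) → X) (e : Fin (n + 1) → ℝ) :
    expSupermartingale k σ τ x e =
      expSupermartingale k σ τ (fun i : Fin n => x i.castSucc) (fun i => e i.castSucc) *
      (Real.exp (1 / 2 * ((e (Fin.last n) ^ 2 - (e (Fin.last n) -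
        postMean k τ (fun i : Fin n => x i.castSucc)
        (fun i : Fin n => e i.castSucc) (x (Fin.last n))) ^ 2 /
        (1 + (τ ^ 2)⁻¹ * postVar k τ (fun i : Fin n => x i.castSucc) (x (Fin.last n)))) / σ ^ 2)) /
        √(1 + (τ ^ 2)⁻¹ * postVar k τ (fun i : Fin n => x i.castSucc) (x (Fin.last n)))) := by
  have hd := one_le_det_one_add_gram hφ (c := (τ ^ 2)⁻¹) (by positivity)
    (fun i : Fin n => x i.castSucc)
  rw [expSupermartingale, noiseQuad_succ hφ σ hτ, det_one_add_gram_succ hφ hτ,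
    Real.sqrt_mul (by linarith), mul_add, Real.exp_add, expSupermartingale]
  ring

theorem lintegral_expSupermartingale_le [MeasurableSpace X]
    (hφ : ∀ z w, k z w = inner ℝ (φ z) (φ w)) (hk : Measurable (Function.uncurry k))
    {σ τ R : ℝ} (hσ : 0 < σ) (hτ : 0 < τ) (hR : 0 ≤ R) (hRσ : R ≤ σ)
    {Ω : Type*} {mΩ : MeasurableSpace Ω} {P : Measure Ω} [IsProbabilityMeasure P]
    {ℱ : Filtration ℕ mΩ} {T : ℕ} {x : ℕ → Ω → X} {ε : ℕ → Ω → ℝ}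
    (hx_meas : ∀ t ∈ Set.Icc 1 T, Measurable[ℱ (t - 1)] (x t))
    (hε_meas : ∀ t ∈ Set.Icc 1 T, Measurable[ℱ t] (ε t))
    (hε : ∀ t ∈ Set.Icc 1 T, CondSubGaussian P (ℱ (t - 1)) R (ε t)) :
    ∀ n ≤ T, ∫⁻ ω, ENNReal.ofReal (expSupermartingale k σ τ (fun i : Fin n => x (i + 1) ω)
      (fun i : Fin n => ε (i + 1) ω)) ∂P ≤ 1 := by
  intro n
  induction n with
  | zero =>
    intro _
    simp [expSupermartingale, noiseQuad, dotProduct]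
  | succ n ih =>
    intro hn
    have hmem : n + 1 ∈ Set.Icc 1 T := ⟨by omega, hn⟩
    have hxn : ∀ i : Fin n, Measurable[ℱ n] (x (i + 1)) := fun i =>
      (hx_meas (i + 1) ⟨by omega, by omega⟩).mono (ℱ.mono (by omega)) le_rfl
    have hεn : ∀ i : Fin n, Measurable[ℱ n] (ε (i + 1)) := fun i =>
      (hε_meas (i + 1) ⟨by omega, by omega⟩).mono (ℱ.mono (by omega)) le_rfl
    have hxl : Measurable[ℱ n] (x (n + 1)) := hx_meas (n + 1) hmem
    have hstep := (hε (n + 1) hmem).lintegral_mul_quad_le (ℱ.le n)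
      ((hε_meas (n + 1) hmem).mono (ℱ.le _) le_rfl) hσ hR hRσ
      (μ := fun ω => postMean k τ (fun i : Fin n => x (i + 1) ω) (fun i : Fin n => ε (i + 1) ω)
        (x (n + 1) ω))
      (D := fun ω => 1 + (τ ^ 2)⁻¹ * postVar k τ (fun i : Fin n => x (i + 1) ω) (x (n + 1) ω))
      (g := fun ω => ENNReal.ofReal (expSupermartingale k σ τ (fun i : Fin n => x (i + 1) ω)
        (fun i : Fin n => ε (i + 1) ω)))
      (measurable_postMean (mΩ := ℱ n) hk τ hxn hεn hxl)
      (((measurable_postVar (mΩ := ℱ n) hk τ hxn hxl).const_mul _).const_add _)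
      (fun ω => by
        have := postVar_nonneg hφ hτ (fun i : Fin n => x (i + 1) ω) (x (n + 1) ω)
        have h2 : 0 ≤ (τ ^ 2)⁻¹ * postVar k τ (fun i : Fin n => x (i + 1) ω) (x (n + 1) ω) := by
          positivity
        linarith)
      (ENNReal.measurable_ofReal.comp
        (measurable_expSupermartingale (mΩ := ℱ n) hk σ τ hxn hεn))
    refine le_trans (le_of_eq (lintegral_congr fun ω => ?_)) (hstep.trans (ih (by omega)))
    rw [expSupermartingale_succ hφ σ hτ, ENNReal.ofReal_mul
      (by rw [expSupermartingale]; positivity)]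
    rfl

end Supermartingale


/-! ### Confidence width and regret -/

section Confidence

variable {X H : Type*} [NormedAddCommGroup H] [InnerProductSpace ℝ H]
  {k : X → X → ℝ} {φ : X → H}

/-- The factor by which the kernel is inflated in the mixture supermartingale, for an information
gain `γ`. Inflating by `γ⁻¹` when `γ` is small keeps the confidence width proportional to `γ`. -/
def gainScale (γ : ℝ) : ℝ := if 0 < γ ∧ γ < 1 / 2 then γ⁻¹ else 1

theorem gainScale_pos (γ : ℝ) : 0 < gainScale γ := by
  rw [gainScale]
  split_ifs with h
  · exact inv_pos.mpr h.1
  · exact one_pos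

/-- Taking logarithms gives `noiseQuad ≤ 4 L + log det` at the regularization used. For `γ ≥ 1/2`
this is already of order `γ L`; for smaller positive `γ` the inflated kernel supplies the factor
`γ`; for `γ = 0` all eigenvalues vanish. -/
theorem noiseQuad_le_of_expSupermartingale_lt (hφ : ∀ z w, k z w = inner ℝ (φ z) (φ w))
    {σ : ℝ} (hσ : 0 < σ) {n : ℕ} (x : Fin n → X) (e : Fin n → ℝ) {γ L : ℝ} (hγ : 0 ≤ γ)
    (hdet : Real.log (1 + (σ ^ 2)⁻¹ • gram k x).det ≤ 2 * γ) (hL : 1 / 2 ≤ L)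
    (hM : expSupermartingale k σ (σ / √(gainScale γ)) x e < Real.exp (2 * L)) :
    noiseQuad k σ σ x e ≤ γ * (20 * L + 10) := by
  obtain ⟨l, hl0, -, hprod, hquad⟩ := exists_spectral_data (gram_posSemidef hφ x)
  obtain ⟨w, hw, hinv⟩ := hquad e
  have hnq : ∀ τ : ℝ, 0 < τ →
      noiseQuad k σ τ x e = ∑ i, w i ^ 2 * (l i / (l i + τ ^ 2)) / σ ^ 2 := by
    intro τ hτ
    rw [noiseQuad, regGram, hinv _ (by positivity), hw, Finset.mul_sum, ← Finset.sum_sub_distrib,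
      Finset.sum_div]
    refine Finset.sum_congr rfl fun i _ => ?_
    have : l i + τ ^ 2 ≠ 0 := by have := hl0 i; positivity
    field_simp
    ring
  have hpos : ∀ c : ℝ, 0 ≤ c → ∀ i, 0 < 1 + c * l i := fun c hc i => by
    have := mul_nonneg hc (hl0 i)
    linarith
  have hlog : ∀ c : ℝ, 0 ≤ c →
      Real.log (1 + c • gram k x).det = ∑ i, Real.log (1 + c * l i) := fun c hc => by
    rw [hprod, Real.log_prod fun i _ => (hpos c hc i).ne']
  have hc0 : 0 ≤ (σ ^ 2)⁻¹ := by positivity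
  have hli : ∀ i, l i ≤ σ ^ 2 * (Real.exp (2 * γ) - 1) := by
    intro i
    have h1 : Real.log (1 + (σ ^ 2)⁻¹ * l i) ≤ 2 * γ := by
      refine le_trans ?_ ((hlog _ hc0).symm.trans_le hdet)
      refine Finset.single_le_sum (f := fun i => Real.log (1 + (σ ^ 2)⁻¹ * l i))
        (fun j _ => Real.log_nonneg ?_) (Finset.mem_univ i)
      have := mul_nonneg hc0 (hl0 j)
      linarith
    rw [Real.log_le_iff_le_exp (hpos _ hc0 i)] at h1
    have h2 : l i = σ ^ 2 * ((σ ^ 2)⁻¹ * l i) := by field_simp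
    rw [h2]
    have : 0 < σ ^ 2 := by positivity
    gcongr
    linarith
  have hM' : ∀ τ : ℝ, 0 < τ → expSupermartingale k σ τ x e < Real.exp (2 * L) →
      noiseQuad k σ τ x e ≤ 4 * L + Real.log (1 + (τ ^ 2)⁻¹ • gram k x).det := by
    intro τ hτ h
    have hd : 0 < (1 + (τ ^ 2)⁻¹ • gram k x).det :=
      one_pos.trans_le (one_le_det_one_add_gram hφ (by positivity) x)
    have hs : √(1 + (τ ^ 2)⁻¹ • gram k x).det =
        Real.exp (1 / 2 * Real.log (1 + (τ ^ 2)⁻¹ • gram k x).det) := by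
      rw [Real.sqrt_eq_rpow, Real.rpow_def_of_pos hd, mul_comm]
    rw [expSupermartingale, hs, ← Real.exp_sub, Real.exp_lt_exp] at h
    linarith
  rcases hγ.eq_or_lt with h0 | hγ0
  · have hl : ∀ i, l i = 0 := fun i => le_antisymm (by simpa [← h0] using hli i) (hl0 i)
    rw [hnq σ hσ, ← h0]
    simp [hl]
  · by_cases hγ1 : γ < 1 / 2
    · have ha : gainScale γ = γ⁻¹ := if_pos ⟨hγ0, hγ1⟩
      set τ := σ / √(gainScale γ) with hτ
      have hτ0 : 0 < τ := div_pos hσ (Real.sqrt_pos.mpr (gainScale_pos γ))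
      have hτ2 : τ ^ 2 = γ * σ ^ 2 := by
        rw [hτ, div_pow, Real.sq_sqrt (gainScale_pos γ).le, ha]
        field_simp
      have h1 := hM' τ hτ0 hM
      have h2 : Real.log (1 + (τ ^ 2)⁻¹ • gram k x).det ≤ 2 := by
        rw [hlog _ (by positivity)]
        -- Bernoulli's inequality with exponent `γ⁻¹ ≥ 1`: inflating the kernel by `γ⁻¹` multiplies
        -- the log-determinant by at most `γ⁻¹`.
        have h3 : ∀ i, Real.log (1 + (τ ^ 2)⁻¹ * l i) ≤ γ⁻¹ * Real.log (1 + (σ ^ 2)⁻¹ * l i) := by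
          intro i
          rw [← Real.log_rpow (hpos _ hc0 i)]
          apply Real.log_le_log (hpos _ (by positivity) i)
          have := one_add_mul_self_le_rpow_one_add (s := (σ ^ 2)⁻¹ * l i) (p := γ⁻¹)
            (by have := mul_nonneg hc0 (hl0 i); linarith)
            ((one_le_inv₀ hγ0).mpr (by linarith))
          rwa [← mul_assoc, ← mul_inv, ← hτ2] at this
        calc _ ≤ ∑ i, γ⁻¹ * Real.log (1 + (σ ^ 2)⁻¹ * l i) := Finset.sum_le_sum fun i _ => h3 i
          _ = γ⁻¹ * Real.log (1 + (σ ^ 2)⁻¹ • gram k x).det := by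
              rw [← Finset.mul_sum, ← hlog _ hc0]
          _ ≤ γ⁻¹ * (2 * γ) := by gcongr
          _ = 2 := by field_simp
      have h4 : Real.exp (2 * γ) - 1 ≤ 4 * γ := by
        have := Real.abs_exp_sub_one_sub_id_le (x := 2 * γ) (by
          rw [abs_of_pos (by positivity)]; linarith)
        have := (abs_le.mp this).2
        nlinarith
      have h5 : noiseQuad k σ σ x e ≤ 5 * γ * noiseQuad k σ τ x e := by
        rw [hnq σ hσ, hnq τ hτ0, Finset.mul_sum]
        refine Finset.sum_le_sum fun i _ => ?_
        -- The factor five is four from `l i ≤ 4 γ σ²` plus one from `τ² = γ σ²`.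
        have h6 : l i / (l i + σ ^ 2) ≤ 5 * γ * (l i / (l i + τ ^ 2)) := by
          have h7 := hl0 i
          rw [hτ2, ← mul_div_assoc, div_le_div_iff₀ (by positivity) (by positivity)]
          have h8 : l i ≤ σ ^ 2 * (4 * γ) := (hli i).trans (by gcongr)
          have h9 : l i + γ * σ ^ 2 ≤ 5 * γ * (l i + σ ^ 2) := by
            have := mul_nonneg hγ h7
            linarith
          calc _ ≤ l i * (5 * γ * (l i + σ ^ 2)) := by gcongr
            _ = _ := by ring
        calc _ ≤ w i ^ 2 * (5 * γ * (l i / (l i + τ ^ 2))) / σ ^ 2 := by gcongr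
          _ = _ := by ring
      calc _ ≤ 5 * γ * noiseQuad k σ τ x e := h5
        _ ≤ 5 * γ * (4 * L + 2) := by gcongr; linarith
        _ = _ := by ring
    · have ha : gainScale γ = 1 := if_neg fun h => hγ1 h.2
      rw [ha, Real.sqrt_one, div_one] at hM
      have h1 := hM' σ hσ hM
      nlinarith

/-- The regularization level of the mixture supermartingale at the round whose information gain is
`maxInfoGain k σ (n + 1)`. -/
def mixScale (k : X → X → ℝ) (σ : ℝ) (n : ℕ) : ℝ :=
  σ / √(gainScale (maxInfoGain k σ (n + 1)))

theorem confidence_bound (hφ : ∀ z w, k z w = inner ℝ (φ z) (φ w)) (hk : ∀ z w, k z w ≤ 1)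
    {σ : ℝ} (hσ : 0 < σ) {n : ℕ} (x : ℕ → X) (e y : ℕ → ℝ) {f : H} {B : ℝ} (hB : ‖f‖ ≤ B)
    (hy : ∀ s ∈ Set.Icc 1 n, y s = inner ℝ f (φ (x s)) + e s) {δ b : ℝ} (hδ : 0 < δ)
    (hδ' : δ < 1)
    (hb : 2 * B ^ 2 + 300 * maxInfoGain k σ (n + 1) * Real.log ((n + 1 : ℕ) / δ) ^ 3 ≤ b)
    (hM : n ≠ 0 → expSupermartingale k σ (mixScale k σ n) (fun i : Fin n => x (i + 1))
      (fun i : Fin n => e (i + 1)) < n * (n + 1) / δ) (z : X) :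
    |inner ℝ f (φ z) - postMean k σ (past x (n + 1)) (past y (n + 1)) z| ≤
      √b * √(postVar k σ (past x (n + 1)) z) := by
  have : Nonempty X := ⟨z⟩
  have hB0 : 0 ≤ B := (norm_nonneg _).trans hB
  set γ := maxInfoGain k σ (n + 1) with hγ
  have hγ0 : 0 ≤ γ := maxInfoGain_nonneg hφ hk hσ _
  set L := Real.log ((n + 1 : ℕ) / δ) with hL
  have hL0 : 0 ≤ L := by
    apply Real.log_nonneg
    rw [one_le_div hδ]
    push_cast
    linarith [(Nat.cast_nonneg n : (0 : ℝ) ≤ n)]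
  have hpast : past y (n + 1) = fun i : Fin n => inner ℝ f (φ (x (i + 1))) + e (i + 1) := by
    funext i
    exact hy _ ⟨by omega, by have := i.2; omega⟩
  set Q := noiseQuad k σ σ (fun i : Fin n => x (i + 1)) (fun i : Fin n => e (i + 1)) with hQ
  have hmain := sub_postMean_abs_le hφ hσ (fun i : Fin n => x (i + 1))
    (fun i : Fin n => e (i + 1)) f hB z
  rw [← hQ] at hmain
  have hQb : 2 * Q ≤ 300 * γ * L ^ 3 := by
    rcases Nat.eq_zero_or_pos n with hn | hn
    · have hQ0 : Q = 0 := by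
        subst hn
        simp [hQ, noiseQuad, dotProduct]
      rw [hQ0, mul_zero]
      positivity
    · have hn1 : (1 : ℝ) ≤ n := by exact_mod_cast hn
      have hL1 : 69 / 100 ≤ L := by
        have h1 : Real.log 2 ≤ L := by
          apply Real.log_le_log two_pos
          rw [le_div_iff₀ hδ]
          push_cast
          linarith
        linarith [Real.log_two_gt_d9]
      have hexp : Real.exp (2 * L) = ((n + 1 : ℕ) / δ) ^ 2 := by
        rw [two_mul, Real.exp_add, hL, Real.exp_log (by positivity), sq]
      have hM1 := hM hn.ne'
      -- The union-bound threshold is at most `((n + 1) / δ) ^ 2`, so it costs only a factor two in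
      -- the logarithm.
      have hle : (n : ℝ) * (n + 1) / δ ≤ Real.exp (2 * L) := by
        rw [hexp, div_pow, div_le_div_iff₀ hδ (by positivity)]
        push_cast
        have h1 : (n : ℝ) * (n + 1) * δ ^ 2 ≤ n * (n + 1) * δ := by
          gcongr
          nlinarith
        have h2 : (n : ℝ) * (n + 1) * δ ≤ (n + 1) ^ 2 * δ := by
          gcongr
          nlinarith
        linarith
      have hq := noiseQuad_le_of_expSupermartingale_lt hφ hσ (fun i : Fin n => x (i + 1))
        (fun i : Fin n => e (i + 1)) hγ0
        (log_det_castSucc_le hφ hk hσ fun i : Fin (n + 1) => x (i + 1))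
        (by linarith) (hM1.trans_le hle)
      -- Since `n ≥ 1` and `δ < 1`, `L` is at least `log 2`, so the cube dominates the linear
      -- expression.
      have hcube : 40 * L + 20 ≤ 300 * L ^ 3 := by
        nlinarith [mul_nonneg (sub_nonneg.mpr hL1) (sub_nonneg.mpr hL1), pow_pos
          (show 0 < L by linarith) 3, mul_nonneg (mul_nonneg (sub_nonneg.mpr hL1)
          (sub_nonneg.mpr hL1)) (show 0 ≤ L by linarith)]
      have h3 := mul_le_mul_of_nonneg_left hcube hγ0
      rw [← hQ] at hq
      linarith
  -- This is `(B + √Q)² ≤ 2 B² + 2 Q`, the source of the coefficient two on `B²`.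
  have hle : B + √Q ≤ √b := by
    apply Real.le_sqrt_of_sq_le
    rcases le_or_gt Q 0 with h | h
    · rw [Real.sqrt_eq_zero_of_nonpos h]
      have : 0 ≤ 300 * γ * L ^ 3 := by positivity
      nlinarith [sq_nonneg B]
    · have := Real.sq_sqrt h.le
      nlinarith [sq_nonneg (B - √Q)]
  rw [hpast, mul_comm]
  exact hmain.trans (mul_le_mul_of_nonneg_left hle (Real.sqrt_nonneg _))

/-- The logarithm lies above its chord from `1` to `1 + s`. With `s = σ⁻²` this trades a variance
for its information term at the price of the constant `C`. -/
theorem mul_log_one_add_le {v s : ℝ} (hs : 0 ≤ s) (hv0 : 0 ≤ v) (hv1 : v ≤ 1) :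
    v * Real.log (1 + s) ≤ Real.log (1 + s * v) := by
  have h := strictConcaveOn_log_Ioi.concaveOn.2 (x := 1) (y := 1 + s) (Set.mem_Ioi.mpr one_pos)
    (Set.mem_Ioi.mpr (by linarith)) (sub_nonneg.mpr hv1) hv0 (by ring)
  simp only [smul_eq_mul, Real.log_one, mul_zero, zero_add] at h
  refine h.trans_eq ?_
  congr 1
  ring

theorem regret_le_of_confidence (hφ : ∀ z w, k z w = inner ℝ (φ z) (φ w))
    (hk : ∀ z w, k z w ≤ 1) {σ : ℝ} (hσ : 0 < σ) {f : X → ℝ} {xstar : X} {T : ℕ} {β : ℕ → ℝ}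
    (hβ : ∀ t ∈ Finset.Icc 1 T, 0 ≤ β t) {x : ℕ → X} {y : ℕ → ℝ}
    (hconf : ∀ t ∈ Finset.Icc 1 T, ∀ z, |f z - postMean k σ (past x t) (past y t) z| ≤
      √(β t) * √(postVar k σ (past x t) z))
    (hucb : ∀ t ∈ Finset.Icc 1 T, ucb k σ (β t) x y t xstar ≤ ucb k σ (β t) x y t (x t)) :
    ∑ t ∈ Finset.Icc 1 T, (f xstar - f (x t)) ≤
      √(T * ∑ t ∈ Finset.Icc 1 T,
        4 * β t * σ ^ 2 * ((σ ^ 2)⁻¹ / Real.log (1 + (σ ^ 2)⁻¹)) *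
          Real.log (1 + (σ ^ 2)⁻¹ * postVar k σ (past x t) (x t))) := by
  have hlog : 0 < Real.log (1 + (σ ^ 2)⁻¹) := Real.log_pos (by
    have : 0 < (σ ^ 2)⁻¹ := by positivity
    linarith)
  set r : ℕ → ℝ := fun t => 2 * (√(β t) * √(postVar k σ (past x t) (x t))) with hr
  have h1 : ∀ t ∈ Finset.Icc 1 T, f xstar - f (x t) ≤ r t := by
    intro t ht
    have ha := (abs_le.mp (hconf t ht xstar)).2
    have hb := (abs_le.mp (hconf t ht (x t))).1
    have hc := hucb t ht
    simp only [ucb] at hc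
    simp only [hr]
    linarith
  have h2 : ∀ t ∈ Finset.Icc 1 T, r t ^ 2 ≤
      4 * β t * σ ^ 2 * ((σ ^ 2)⁻¹ / Real.log (1 + (σ ^ 2)⁻¹)) *
          Real.log (1 + (σ ^ 2)⁻¹ * postVar k σ (past x t) (x t)) := by
    intro t ht
    have hv0 := postVar_nonneg hφ hσ (past x t) (x t)
    have hv1 := (postVar_le hφ hσ (past x t) (x t)).trans (hk _ _)
    have hb := hβ t ht
    set v := postVar k σ (past x t) (x t)
    have h3 := mul_log_one_add_le (s := (σ ^ 2)⁻¹) (by positivity) hv0 hv1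
    have h4 : r t ^ 2 = 4 * β t * v := by
      simp only [hr]
      rw [mul_pow, mul_pow, Real.sq_sqrt hb, Real.sq_sqrt hv0]
      ring
    have h5 : v ≤ Real.log (1 + (σ ^ 2)⁻¹ * v) / Real.log (1 + (σ ^ 2)⁻¹) := by
      rwa [le_div_iff₀ hlog]
    rw [h4]
    calc 4 * β t * v ≤ 4 * β t * (Real.log (1 + (σ ^ 2)⁻¹ * v) / Real.log (1 + (σ ^ 2)⁻¹)) := by
          gcongr
      _ = _ := by field_simp
  refine (Finset.sum_le_sum h1).trans (Real.le_sqrt_of_sq_le ?_)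
  refine sq_sum_le_card_mul_sum_sq.trans ?_
  rw [Nat.card_Icc, Nat.add_sub_cancel]
  gcongr with t ht
  exact h2 t ht

end Confidence

/-! ### Union bound over the sample sizes -/

theorem sum_inv_succ_mul_le (N : ℕ) :
    ∑ n ∈ Finset.range N, 1 / (((n + 1 : ℕ) : ℝ) * ((n + 1 : ℕ) + 1)) ≤ 1 - 1 / (N + 1) := by
  induction N with
  | zero => simp
  | succ N ih =>
    rw [Finset.sum_range_succ]
    have : 1 / (((N + 1 : ℕ) : ℝ) * ((N + 1 : ℕ) + 1)) =
        1 / ((N : ℝ) + 1) - 1 / (((N + 1 : ℕ) : ℝ) + 1) := by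
      push_cast
      field_simp
      ring
    linarith

/-- With probability at least `1 - δ`, the supermartingales of all rounds stay below their
thresholds. -/
theorem measure_exists_expSupermartingale_ge_le {X H : Type*} [MeasurableSpace X]
    [NormedAddCommGroup H] [InnerProductSpace ℝ H] {k : X → X → ℝ} {φ : X → H}
    (hφ : ∀ z w, k z w = inner ℝ (φ z) (φ w)) (hk : Measurable (Function.uncurry k))
    {σ R δ : ℝ} (hσ : 0 < σ) (hR : 0 ≤ R) (hRσ : R ≤ σ) (hδ : 0 < δ)
    {Ω : Type*} {mΩ : MeasurableSpace Ω} {P : Measure Ω} [IsProbabilityMeasure P]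
    {ℱ : Filtration ℕ mΩ} {T : ℕ} {x : ℕ → Ω → X} {ε : ℕ → Ω → ℝ}
    (hx_meas : ∀ t ∈ Set.Icc 1 T, Measurable[ℱ (t - 1)] (x t))
    (hε_meas : ∀ t ∈ Set.Icc 1 T, Measurable[ℱ t] (ε t))
    (hε : ∀ t ∈ Set.Icc 1 T, CondSubGaussian P (ℱ (t - 1)) R (ε t)) :
    P {ω | ∃ n ∈ Finset.range T, (((n + 1 : ℕ) : ℝ) * ((n + 1 : ℕ) + 1)) / δ ≤
      expSupermartingale k σ (mixScale k σ (n + 1)) (fun i : Fin (n + 1) => x (i + 1) ω)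
        (fun i : Fin (n + 1) => ε (i + 1) ω)} ≤ ENNReal.ofReal δ := by
  have hset : {ω | ∃ n ∈ Finset.range T, (((n + 1 : ℕ) : ℝ) * ((n + 1 : ℕ) + 1)) / δ ≤
      expSupermartingale k σ (mixScale k σ (n + 1)) (fun i : Fin (n + 1) => x (i + 1) ω)
        (fun i : Fin (n + 1) => ε (i + 1) ω)} =
      ⋃ n ∈ Finset.range T, {ω | (((n + 1 : ℕ) : ℝ) * ((n + 1 : ℕ) + 1)) / δ ≤
        expSupermartingale k σ (mixScale k σ (n + 1)) (fun i : Fin (n + 1) => x (i + 1) ω)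
        (fun i : Fin (n + 1) => ε (i + 1) ω)} := by
    ext ω
    simp
  rw [hset]
  refine (measure_biUnion_finset_le _ _).trans ?_
  have hbound : ∀ n ∈ Finset.range T, P {ω | (((n + 1 : ℕ) : ℝ) * ((n + 1 : ℕ) + 1)) / δ ≤
      expSupermartingale k σ (mixScale k σ (n + 1)) (fun i : Fin (n + 1) => x (i + 1) ω)
        (fun i : Fin (n + 1) => ε (i + 1) ω)} ≤
      ENNReal.ofReal (δ * (1 / (((n + 1 : ℕ) : ℝ) * ((n + 1 : ℕ) + 1)))) := by
    intro n hn
    have hn' : n + 1 ≤ T := Finset.mem_range.mp hn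
    have hτ : 0 < mixScale k σ (n + 1) := div_pos hσ (Real.sqrt_pos.mpr (gainScale_pos _))
    have hthr : 0 < (((n + 1 : ℕ) : ℝ) * ((n + 1 : ℕ) + 1)) / δ := by positivity
    have hmeas : Measurable fun ω => ENNReal.ofReal
        (expSupermartingale k σ (mixScale k σ (n + 1)) (fun i : Fin (n + 1) => x (i + 1) ω)
          (fun i : Fin (n + 1) => ε (i + 1) ω)) :=
      ENNReal.measurable_ofReal.comp (measurable_expSupermartingale hk _ _
        (fun i => (hx_meas (i + 1) ⟨by omega, by omega⟩).mono (ℱ.le _) le_rfl)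
        (fun i => (hε_meas (i + 1) ⟨by omega, by omega⟩).mono (ℱ.le _) le_rfl))
    have hmk := meas_ge_le_lintegral_div (μ := P) hmeas.aemeasurable
      (ε := ENNReal.ofReal ((((n + 1 : ℕ) : ℝ) * ((n + 1 : ℕ) + 1)) / δ))
      (by simpa using hthr) ENNReal.ofReal_ne_top
    have hint := lintegral_expSupermartingale_le hφ hk hσ hτ hR hRσ hx_meas hε_meas hε (n + 1) hn'
    calc _ ≤ P {ω | ENNReal.ofReal ((((n + 1 : ℕ) : ℝ) * ((n + 1 : ℕ) + 1)) / δ) ≤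
          ENNReal.ofReal (expSupermartingale k σ (mixScale k σ (n + 1))
            (fun i : Fin (n + 1) => x (i + 1) ω) (fun i : Fin (n + 1) => ε (i + 1) ω))} :=
          measure_mono fun ω hω => ENNReal.ofReal_le_ofReal hω
      _ ≤ _ := hmk
      _ ≤ 1 / ENNReal.ofReal ((((n + 1 : ℕ) : ℝ) * ((n + 1 : ℕ) + 1)) / δ) :=
          ENNReal.div_le_div_right hint _
      _ = _ := by
          rw [one_div, ← ENNReal.ofReal_inv_of_pos hthr, inv_div, mul_one_div]
  refine (Finset.sum_le_sum hbound).trans ?_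
  rw [← ENNReal.ofReal_sum_of_nonneg (fun n _ => by positivity), ← Finset.mul_sum]
  apply ENNReal.ofReal_le_ofReal
  have h1 := sum_inv_succ_mul_le T
  have h2 : (0 : ℝ) ≤ 1 / (T + 1) := by positivity
  calc δ * _ ≤ δ * 1 := by gcongr; linarith
    _ = δ := mul_one δ

end GPUCB

end

/-! ### The regret bound -/

theorem mainTheorem4
    -- the compact input space and a fixed measurable kernel bounded by one
    {d : ℕ} (X : Set (EuclideanSpace ℝ (Fin d))) (hX : IsCompact X)
    (k : X → X → ℝ) (hk_meas : Measurable (Function.uncurry k)) (hk_le : ∀ z w, k z w ≤ 1)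
    -- the reproducing kernel Hilbert space of the kernel, and the objective in it
    {H : Type*} [NormedAddCommGroup H] [InnerProductSpace ℝ H] [CompleteSpace H]
    [RKHS ℝ H X ℝ] (hH : ∀ z w, RKHS.kernel H z w 1 = k z w)
    (f : H) (B : ℝ) (hB : ‖f‖ ≤ B) (xstar : X) (hstar : ∀ z, f z ≤ f xstar)
    -- the noise parameter of the surrogate and the sub-Gaussian constant of the noise
    (σ R : ℝ) (hσ : 0 < σ) (hR : 0 ≤ R) (hRσ : R ≤ σ)
    -- the confidence level, the horizon and the exploration parameters
    (δ : ℝ) (hδ : 0 < δ) (hδ' : δ < 1) (T : ℕ) (β : ℕ → ℝ → ℝ)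
    (hβ_mono : MonotoneOn (fun t => β t δ) (Set.Icc 1 T))
    (hβ : ∀ t ∈ Set.Icc 1 T,
      2 * B ^ 2 + 300 * GPUCB.maxInfoGain k σ t * Real.log (t / δ) ^ 3 ≤ β t δ)
    -- the queries, the noise and the observations
    {Ω : Type*} {mΩ : MeasurableSpace Ω} (P : Measure Ω) [IsProbabilityMeasure P]
    (ℱ : Filtration ℕ mΩ) (x : ℕ → Ω → X) (ε y : ℕ → Ω → ℝ)
    (hx_meas : ∀ t ∈ Set.Icc 1 T, Measurable[ℱ (t - 1)] (x t))
    (hε_meas : ∀ t ∈ Set.Icc 1 T, Measurable[ℱ t] (ε t))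
    (hε : ∀ t ∈ Set.Icc 1 T, GPUCB.CondSubGaussian P (ℱ (t - 1)) R (ε t))
    (hy : ∀ t ∈ Set.Icc 1 T, ∀ ω, y t ω = f (x t ω) + ε t ω)
    -- every query maximizes the upper confidence bound
    (hucb : ∀ t ∈ Set.Icc 1 T, ∀ ω, ∀ z,
      GPUCB.ucb k σ (β t δ) (fun s => x s ω) (fun s => y s ω) t z ≤
        GPUCB.ucb k σ (β t δ) (fun s => x s ω) (fun s => y s ω) t (x t ω)) :
    1 - δ ≤ P.real {ω | ∑ t ∈ Finset.Icc 1 T, (f xstar - f (x t ω)) ≤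
      √(T * ∑ t ∈ Finset.Icc 1 T,
        4 * β t δ * σ ^ 2 * ((σ ^ 2)⁻¹ / Real.log (1 + (σ ^ 2)⁻¹)) *
          Real.log (1 + (σ ^ 2)⁻¹ *
            GPUCB.postVar k σ (GPUCB.past (fun s => x s ω) t) (x t ω)))} := by
  set φ : X → H := fun z => RKHS.kerFun H z (1 : ℝ) with hφdef
  have hφ : ∀ z w, k z w = inner ℝ (φ z) (φ w) := by
    intro z w
    rw [← hH, hφdef, RKHS.kerFun_inner, RKHS.kerFun_apply]
    simp
  have hf : ∀ z, f z = inner ℝ f (φ z) := by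
    intro z
    rw [hφdef, RKHS.inner_kerFun]
    simp
  have : Nonempty X := ⟨xstar⟩
  have hβ0 : ∀ t ∈ Finset.Icc 1 T, 0 ≤ β t δ := by
    intro t ht
    rw [Finset.mem_Icc] at ht
    refine le_trans ?_ (hβ t ht)
    have h1 := GPUCB.maxInfoGain_nonneg hφ hk_le hσ t
    have h2 : 0 ≤ Real.log (t / δ) := by
      apply Real.log_nonneg
      rw [one_le_div hδ]
      have : (1 : ℝ) ≤ t := by exact_mod_cast ht.1
      linarith
    positivity
  have hbad := GPUCB.measure_exists_expSupermartingale_ge_le hφ hk_meas hσ hR hRσ hδ hx_meas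
    hε_meas hε
  set bad : Set Ω := {ω | ∃ n ∈ Finset.range T, (((n + 1 : ℕ) : ℝ) * ((n + 1 : ℕ) + 1)) / δ ≤
      GPUCB.expSupermartingale k σ (GPUCB.mixScale k σ (n + 1))
        (fun i : Fin (n + 1) => x (i + 1) ω) (fun i : Fin (n + 1) => ε (i + 1) ω)} with hbaddef
  set good : Set Ω := {ω | ∑ t ∈ Finset.Icc 1 T, (f xstar - f (x t ω)) ≤
      √(T * ∑ t ∈ Finset.Icc 1 T,
        4 * β t δ * σ ^ 2 * ((σ ^ 2)⁻¹ / Real.log (1 + (σ ^ 2)⁻¹)) *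
          Real.log (1 + (σ ^ 2)⁻¹ *
            GPUCB.postVar k σ (GPUCB.past (fun s => x s ω) t) (x t ω)))} with hgood
  -- Covering the space and subadditivity suffice, so measurability of the regret event is not
  -- needed.
  have hcover : (Set.univ : Set Ω) ⊆ good ∪ bad := by
    intro ω _
    by_cases hω : ω ∈ bad
    · exact Or.inr hω
    · refine Or.inl (GPUCB.regret_le_of_confidence hφ hk_le hσ (f := fun z => f z) (β := fun t => β t δ)
        (x := fun s => x s ω) (y := fun s => y s ω) hβ0 (fun t ht z => ?_)
        (fun t ht => hucb t (Finset.mem_Icc.mp ht) ω xstar))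
      rw [Finset.mem_Icc] at ht
      obtain ⟨n, rfl⟩ : ∃ n, t = n + 1 := ⟨t - 1, by omega⟩
      rw [hf]
      refine GPUCB.confidence_bound hφ hk_le hσ (fun s => x s ω) (fun s => ε s ω) (fun s => y s ω)
        hB (fun s hs => ?_) hδ hδ' (hβ (n + 1) ht) (fun hn => ?_) z
      · rw [← hf]
        exact hy s ⟨hs.1, by have := hs.2; omega⟩ ω
      · obtain ⟨j, rfl⟩ := Nat.exists_eq_succ_of_ne_zero hn
        by_contra! hcon
        exact hω ⟨j, Finset.mem_range.mpr (by omega), hcon⟩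
  have h1 : (1 : ℝ) ≤ P.real good + P.real bad := by
    rw [← probReal_univ (μ := P)]
    exact (measureReal_mono hcover).trans (measureReal_union_le _ _)
  have h2 : P.real bad ≤ δ := ENNReal.toReal_le_of_le_ofReal hδ.le hbad
  linarith
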